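/- **Theorem (FairX-LinUCB Fairness Regret).** In each round $t=1,2,\dots$ a learner is shown context vectors $x_{t,1},\dots,x_{t,K}\in\mathbb{R}^d$ ($d\ge 1$), which may depend on the past, selects an arm $a_t\in\{1,\dots,K\}$ at random and observes a reward $r_t$ whose conditional mean, given the past, the contexts of round $t$ and $a_t$, is $\mu^\star\cdot x_{t,a_t}$ for an unknown $\mu^\star\in\mathbb{R}^d$. Let $\gamma,L>0$ and let $f:\mathbb{R}\to\mathbb{R}$ be a merit function with $f(y)\ge\gamma$ and $|f(y)-f(z)|\le L|y-z|$ for all $y,z\in\mathbb{R}$. For $\theta\in\mathbb{R}^d$ put $$\pi_{t,\theta}(a)=\frac{f(\theta\cdot x_{t,a})}{\sum_{a'}f(\theta\cdot x_{t,a'})}.$$ FairX-LinUCB with inputs $\lambda$, $f$ and $(\beta_t)_{t\ge1}$ computes in round $t$ $$V_t=\lambda I+\sum_{\tau<t}x_{\tau,a_\tau}x_{\tau,a_\tau}^\top,\qquad \hat\theta_t=V_t^{-1}\sum_{\tau<t}r_\tau x_{\tau,a_\tau},$$ picks a maximizer $\theta_t$ of $\sum_a\pi_{t,\theta}(a)\,\theta\cdot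 x_{t,a}$ over all $\theta$ with $\sqrt{(\theta-\hat\theta_t)^\top V_t(\theta-\hat\theta_t)}\le\sqrt{\beta_t}$, and samples $a_t$ from $\pi_{t,\theta_t}$. Its fairness regret after $T$ rounds is $$\mathrm{FR}_T=\sum_{t=1}^T\sum_a\left|\pi_{t,\mu^\star}(a)-\pi_{t,\theta_t}(a)\right|.$$ There are absolute constants $C$ and $k$ with the following property. Assume that $\|x_{t,a}\|_2\le1$ for all $t,a$, that $\|\mu^\star\|_2\le1$, and that the noise $\eta_t=r_t-\mu^\star\cdot x_{t,a_t}$ is $1$-sub-Gaussian, that is, conditionally on the past, the contexts of round $t$ and $a_t$, $\mathbb{E}[e^{s\eta_t}]\le e^{s^2/2}$ for all $s\in\mathbb{R}$. Let $\delta\in(0,1)$, and run FairX-LinUCB with $\lambda=1$ and $$\beta_t=\left(1+\sqrt{d\ln\left(1+\tfrac td\right)+2\ln\tfrac{\pi^2t^2}{3\delta}}\right)^2.$$ Then, for every $T\ge1$, with probability at least $1-\delta$, $$\mathrm{FR}_T\le C\,\frac{L\,d\sqrt T}{\gamma}\,\left(\ln\left(2+\tfrac T\delta\right)\right)^k,$$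 that is, $\mathrm{FR}_T=\widetilde O(L\,d\sqrt T/\gamma)$ with high probability. -/

import Mathlib

open MeasureTheory
open scoped BigOperators

/-- Vectors of `ℝ^d` with the Euclidean norm. -/
abbrev Vec (d : ℕ) : Type := EuclideanSpace ℝ (Fin d)

/-- The fair policy of a parameter `θ`: arm `a`, with context `x a`, is selected with probability
proportional to its merit `f (θ ⬝ x a)`. -/
noncomputable def fairPolicy {d K : ℕ} (f : ℝ → ℝ) (θ : Vec d) (x : Fin K → Vec d)
    (a : Fin K) : ℝ :=
  f (inner ℝ θ (x a)) / ∑ b, f (inner ℝ θ (x b))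

/-- The expected reward, if `θ` were the true parameter, of the fair policy of `θ`. -/
noncomputable def optimisticValue {d K : ℕ} (f : ℝ → ℝ) (x : Fin K → Vec d) (θ : Vec d) : ℝ :=
  ∑ a, fairPolicy f θ x a * inner ℝ θ (x a)

/-- The random quantities of an interaction with `K` arms in `ℝ^d`. Rounds are `t = 1, 2, …`;
the values at `t = 0` play no role. -/
structure Interaction (Ω : Type*) (d K : ℕ) where
  /-- the contexts `x_{t,1}, …, x_{t,K}` -/
  context : ℕ → Ω → Fin K → Vec d
  /-- the parameter `θ_t` from which the learner builds its policy -/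
  param : ℕ → Ω → Vec d
  /-- the selected arm `a_t` -/
  arm : ℕ → Ω → Fin K
  /-- the observed reward `r_{t,a_t}` -/
  reward : ℕ → Ω → ℝ

namespace Interaction

variable {Ω : Type*} {d K : ℕ}

/-- The context `x_{t,a_t}` of the selected arm. -/
def chosen (X : Interaction Ω d K) (t : ℕ) (ω : Ω) : Vec d :=
  X.context t ω (X.arm t ω)

/-- `V_t = lam I + ∑_{τ<t} x_{τ,a_τ} x_{τ,a_τ}ᵀ`. -/
noncomputable def covMatrix (X : Interaction Ω d K) (lam : ℝ) (t : ℕ) (ω : Ω) :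
    Matrix (Fin d) (Fin d) ℝ :=
  lam • (1 : Matrix (Fin d) (Fin d) ℝ) +
    ∑ τ ∈ Finset.Ico 1 t, Matrix.vecMulVec (X.chosen τ ω).ofLp (X.chosen τ ω).ofLp

/-- `b_t = ∑_{τ<t} r_{τ,a_τ} x_{τ,a_τ}`. -/
noncomputable def bVec (X : Interaction Ω d K) (t : ℕ) (ω : Ω) : Vec d :=
  ∑ τ ∈ Finset.Ico 1 t, X.reward τ ω • X.chosen τ ω

/-- The ridge regression solution `V_t⁻¹ b_t`. -/
noncomputable def ridge (X : Interaction Ω d K) (lam : ℝ) (t : ℕ) (ω : Ω) : Vec d :=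
  WithLp.toLp 2 (Matrix.mulVec (X.covMatrix lam t ω)⁻¹ (X.bVec t ω).ofLp)

/-- The confidence ellipsoid of all `θ` whose distance to the ridge regression solution, in the
norm `‖v‖ = √(vᵀ V_t v)`, is at most `√(β t)`. -/
def confRegion (X : Interaction Ω d K) (lam : ℝ) (β : ℕ → ℝ) (t : ℕ) (ω : Ω) : Set (Vec d) :=
  {θ | √(dotProduct (θ - X.ridge lam t ω).ofLp
      (Matrix.mulVec (X.covMatrix lam t ω) (θ - X.ridge lam t ω).ofLp)) ≤ √(β t)}

/-- The policy deployed in round `t`, the fair policy of the learner's parameter. -/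
noncomputable def policy (X : Interaction Ω d K) (f : ℝ → ℝ) (t : ℕ) (ω : Ω) (a : Fin K) : ℝ :=
  fairPolicy f (X.param t ω) (X.context t ω) a

/-- The optimal fair policy of round `t`, the fair policy of the true parameter. -/
noncomputable def optPolicy (X : Interaction Ω d K) (f : ℝ → ℝ) (μstar : Vec d) (t : ℕ) (ω : Ω)
    (a : Fin K) : ℝ :=
  fairPolicy f μstar (X.context t ω) a

/-- The fairness regret after `T` rounds. -/
noncomputable def fairnessRegret (X : Interaction Ω d K) (f : ℝ → ℝ) (μstar : Vec d) (T : ℕ)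
    (ω : Ω) : ℝ :=
  ∑ t ∈ Finset.Icc 1 T, ∑ a, |X.optPolicy f μstar t ω a - X.policy f t ω a|

/-- The noise `η_t = r_{t,a_t} - μstar ⬝ x_{t,a_t}`. -/
noncomputable def noise (X : Interaction Ω d K) (μstar : Vec d) (t : ℕ) (ω : Ω) : ℝ :=
  X.reward t ω - inner ℝ μstar (X.chosen t ω)

/-- The information available in round `t` just before the reward is drawn: the information
`ℱ t` available when the policy is chosen, and the selected arm. -/
abbrev preReward {mΩ : MeasurableSpace Ω} (X : Interaction Ω d K) (ℱ : Filtration ℕ mΩ) (t : ℕ) :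
    MeasurableSpace Ω :=
  ℱ t ⊔ MeasurableSpace.comap (X.arm t) ⊤

/-- The stochastic linear bandit environment with true parameter `μstar`. The σ-algebra `ℱ t` is
the information available in round `t` when the policy is chosen: it contains the history of the
previous rounds and the contexts of round `t`. The contexts may depend on the past in any way;
the mean reward of the selected arm, given the past, is `μstar ⬝ x_{t,a_t}`. -/
structure IsLinearBandit {mΩ : MeasurableSpace Ω} (X : Interaction Ω d K) (P : Measure Ω)
    (ℱ : Filtration ℕ mΩ) (μstar : Vec d) : Prop where
  context_meas : ∀ t, 1 ≤ t → ∀ a, Measurable[ℱ t] (fun ω => X.context t ω a)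
  arm_meas : ∀ t, 1 ≤ t → Measurable[ℱ (t + 1)] (X.arm t)
  reward_meas : ∀ t, 1 ≤ t → Measurable[ℱ (t + 1)] (X.reward t)
  reward_integrable : ∀ t, 1 ≤ t → Integrable (X.reward t) P
  mean_reward : ∀ t, 1 ≤ t →
    P[X.reward t | X.preReward ℱ t] =ᵐ[P] fun ω => inner ℝ μstar (X.chosen t ω)

/-- The learner runs the FairX-LinUCB algorithm with inputs `β`, `f`, `lam`: in each round it
picks, on the basis of the available information, a maximizer `θ_t` of the optimistic value over
the confidence region (ties may be broken in any way), and then samples the arm from the fair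
policy of `θ_t`. -/
structure IsFairXLinUCB {mΩ : MeasurableSpace Ω} (X : Interaction Ω d K) (P : Measure Ω)
    (ℱ : Filtration ℕ mΩ) (β : ℕ → ℝ) (f : ℝ → ℝ) (lam : ℝ) : Prop where
  param_meas : ∀ t, 1 ≤ t → Measurable[ℱ t] (X.param t)
  param_mem : ∀ t, 1 ≤ t → ∀ ω, X.param t ω ∈ X.confRegion lam β t ω
  param_max : ∀ t, 1 ≤ t → ∀ ω,
    IsMaxOn (optimisticValue f (X.context t ω)) (X.confRegion lam β t ω) (X.param t ω)
  arm_law : ∀ t, 1 ≤ t → ∀ a,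
    P[Set.indicator {ω | X.arm t ω = a} (fun _ => (1 : ℝ)) | ℱ t] =ᵐ[P]
      fun ω => X.policy f t ω a

end Interaction

/-- `Y` is conditionally `σ`-sub-Gaussian given the σ-algebra `m`:
`E[exp (s Y) | m] ≤ exp (σ² s² / 2)` almost surely, for every real `s`. -/
def IsCondSubGaussian {Ω : Type*} {mΩ : MeasurableSpace Ω} (P : Measure Ω)
    (m : MeasurableSpace Ω) (Y : Ω → ℝ) (σ : ℝ) : Prop :=
  ∀ s : ℝ, Integrable (fun ω => Real.exp (s * Y ω)) P ∧
    P[fun ω => Real.exp (s * Y ω) | m] ≤ᵐ[P] fun _ => Real.exp (σ ^ 2 * s ^ 2 / 2)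

/-- The choice of the confidence radius for true parameters of norm at most `1`:
`β_t = (1 + √(d ln(1 + t/d) + 2 ln(π² t² / (3δ))))²`. -/
noncomputable def confRadius (d : ℕ) (δ : ℝ) (t : ℕ) : ℝ :=
  (1 + √(d * Real.log (1 + t / d) + 2 * Real.log (Real.pi ^ 2 * t ^ 2 / (3 * δ)))) ^ 2

/-! Write `‖x‖` for the width of `x`, its norm with respect to `V_t⁻¹`, and `ℓ = ln(2 + T/δ)`. Three
estimates combine.

Confidence. The ridge error is `V_t⁻¹(μstar - S_t)` up to sign, where `S_t` is the noise-weighted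
sum of chosen contexts. For fixed `θ`, the exponential of `θ·S_t - ½∑(θ·x_τ)²` is a supermartingale;
mixing over a standard Gaussian `θ` gives `det(V_t)^(-1/2) exp(½ S_tᵀV_t⁻¹S_t)`, of mean at most 1.
Markov's inequality and a union bound over rounds (`measure_noiseSum_gt_le`,
`measure_notMem_confRegion_le`) put `μstar` in all ellipsoids of rounds `1..T` outside an event of
probability `δ/2`. Then `θ_t` and `μstar` share an ellipsoid, so their predictions at `x` differ by
at most `2√β_t ‖x‖`.

Policies. Since `f ≥ γ`, an unweighted sum over arms is dominated by `1/γ` times a merit-weighted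
one. Hence the distance of the two policies is at most `2L/γ` times the mean prediction gap under
the deployed policy (`sum_abs_fairPolicy_sub_le`), with no factor `K`. The regret is thereby
controlled by `∑ E‖x_{t,a}‖`, the arm being drawn from the policy actually sampled.

Widths. Because widths lie in `[0,1]`, expected widths sum to at most twice the realised ones plus
`2 ln(2/δ)`, outside another event of probability `δ/2` (`measure_sum_meanWidth_gt_le`). The
realised ones are `O(√(T d ℓ))` by Cauchy-Schwarz and the elliptical potential lemma
(`sum_width_sq_le`). Multiplying by `√β_t = O(√(d ℓ))` gives the rate. -/

open scoped Matrix

/-! ### Norms and determinants of positive definite matrices -/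

section LinearAlgebra

variable {n : Type*} [Fintype n]

open scoped MatrixOrder in
-- With this factorisation the norms of `V` and `V⁻¹` become Euclidean norms after applying `B` and
-- `(B⁻¹)ᵀ`, so Euclidean inequalities transfer to them.
theorem Matrix.PosDef.exists_transpose_mul_self [DecidableEq n] {V : Matrix n n ℝ} (hV : V.PosDef) :
    ∃ B : Matrix n n ℝ, V = Bᵀ * B ∧ IsUnit B.det := by
  obtain ⟨B, hB⟩ := CStarAlgebra.nonneg_iff_eq_star_mul_self.mp
    (Matrix.nonneg_iff_posSemidef.mpr hV.posSemidef)
  have hB' : V = Bᵀ * B := by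
    rw [hB, Matrix.star_eq_conjTranspose, Matrix.conjTranspose_eq_transpose_of_trivial]
  refine ⟨B, hB', isUnit_iff_ne_zero.mpr fun h0 => hV.det_pos.ne' ?_⟩
  rw [hB', Matrix.det_mul, h0, mul_zero]

theorem Matrix.dotProduct_transpose_mul_self_mulVec (B : Matrix n n ℝ) (u v : n → ℝ) :
    u ⬝ᵥ ((Bᵀ * B) *ᵥ v) = (B *ᵥ u) ⬝ᵥ (B *ᵥ v) := by
  rw [← Matrix.mulVec_mulVec, Matrix.dotProduct_mulVec, Matrix.vecMul_transpose]

theorem Matrix.dotProduct_inv_transpose_mul_self_mulVec [DecidableEq n] (B : Matrix n n ℝ) (u v : n → ℝ) :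
    u ⬝ᵥ ((Bᵀ * B)⁻¹ *ᵥ v) = ((B⁻¹)ᵀ *ᵥ u) ⬝ᵥ ((B⁻¹)ᵀ *ᵥ v) := by
  rw [Matrix.mul_inv_rev, ← Matrix.transpose_nonsing_inv, ← Matrix.mulVec_mulVec,
    Matrix.dotProduct_mulVec, ← Matrix.mulVec_transpose]

theorem dotProduct_sq_le (u v : n → ℝ) : (u ⬝ᵥ v) ^ 2 ≤ (u ⬝ᵥ u) * (v ⬝ᵥ v) := by
  simpa [dotProduct, sq] using Finset.sum_mul_sq_le_sq_mul_sq Finset.univ u v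

theorem zero_le_dotProduct_self (u : n → ℝ) : 0 ≤ u ⬝ᵥ u :=
  Finset.sum_nonneg fun i _ => mul_self_nonneg (u i)

theorem abs_dotProduct_le_sqrt_mul_sqrt (u v : n → ℝ) :
    |u ⬝ᵥ v| ≤ √(u ⬝ᵥ u) * √(v ⬝ᵥ v) := by
  rw [← Real.sqrt_mul (zero_le_dotProduct_self u)]
  exact Real.abs_le_sqrt (dotProduct_sq_le u v)

theorem sqrt_dotProduct_sub_le (u v : n → ℝ) :
    √((u - v) ⬝ᵥ (u - v)) ≤ √(u ⬝ᵥ u) + √(v ⬝ᵥ v) := by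
  have h := (abs_le.mp (abs_dotProduct_le_sqrt_mul_sqrt u v)).1
  refine Real.sqrt_le_iff.mpr ⟨by positivity, ?_⟩
  have hu := Real.sq_sqrt (zero_le_dotProduct_self u)
  have hv := Real.sq_sqrt (zero_le_dotProduct_self v)
  rw [sub_dotProduct, dotProduct_sub, dotProduct_sub, dotProduct_comm v u]
  nlinarith

theorem Matrix.PosDef.sqrt_dotProduct_mulVec_sub_le [DecidableEq n] {V : Matrix n n ℝ} (hV : V.PosDef)
    (u v : n → ℝ) :
    √((u - v) ⬝ᵥ (V *ᵥ (u - v))) ≤ √(u ⬝ᵥ (V *ᵥ u)) + √(v ⬝ᵥ (V *ᵥ v)) := by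
  obtain ⟨B, rfl, -⟩ := hV.exists_transpose_mul_self
  rw [Matrix.dotProduct_transpose_mul_self_mulVec, Matrix.dotProduct_transpose_mul_self_mulVec,
    Matrix.dotProduct_transpose_mul_self_mulVec, Matrix.mulVec_sub]
  exact sqrt_dotProduct_sub_le (B *ᵥ u) (B *ᵥ v)

/-- The Cauchy-Schwarz inequality for the dual norms of `V` and `V⁻¹`. -/
theorem Matrix.PosDef.abs_dotProduct_le [DecidableEq n] {V : Matrix n n ℝ} (hV : V.PosDef) (u x : n → ℝ) :
    |u ⬝ᵥ x| ≤ √(u ⬝ᵥ (V *ᵥ u)) * √(x ⬝ᵥ (V⁻¹ *ᵥ x)) := by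
  obtain ⟨B, rfl, hB⟩ := hV.exists_transpose_mul_self
  rw [Matrix.dotProduct_transpose_mul_self_mulVec, Matrix.dotProduct_inv_transpose_mul_self_mulVec]
  have : u ⬝ᵥ x = (B *ᵥ u) ⬝ᵥ ((B⁻¹)ᵀ *ᵥ x) := by
    rw [Matrix.dotProduct_mulVec, Matrix.vecMul_transpose, Matrix.mulVec_mulVec,
      Matrix.nonsing_inv_mul _ hB, Matrix.one_mulVec]
  rw [this]
  exact abs_dotProduct_le_sqrt_mul_sqrt _ _

/-- With `y = V⁻¹x`, the hypothesis reads `y·y ≤ x·y`, and Cauchy-Schwarz gives `(x·y)² ≤ (x·x)(y·y)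
≤ (x·x)(x·y)`. -/
theorem Matrix.PosDef.dotProduct_inv_mulVec_le [DecidableEq n] {V : Matrix n n ℝ} (hV : V.PosDef)
    (h1 : ∀ u, u ⬝ᵥ u ≤ u ⬝ᵥ (V *ᵥ u)) (x : n → ℝ) :
    x ⬝ᵥ (V⁻¹ *ᵥ x) ≤ x ⬝ᵥ x := by
  have hy := h1 (V⁻¹ *ᵥ x)
  rw [Matrix.mulVec_mulVec, Matrix.mul_nonsing_inv _ (isUnit_iff_ne_zero.mpr hV.det_pos.ne'),
    Matrix.one_mulVec, dotProduct_comm _ x] at hy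
  have hcs := dotProduct_sq_le x (V⁻¹ *ᵥ x)
  have h0 := zero_le_dotProduct_self (V⁻¹ *ᵥ x)
  have hx := zero_le_dotProduct_self x
  by_contra! hlt
  nlinarith

theorem Matrix.PosDef.dotProduct_inv_mulVec_nonneg [DecidableEq n] {V : Matrix n n ℝ} (hV : V.PosDef)
    (x : n → ℝ) : 0 ≤ x ⬝ᵥ (V⁻¹ *ᵥ x) := by
  simpa using hV.inv.posSemidef.dotProduct_mulVec_nonneg x

theorem Matrix.det_add_vecMulVec_self [DecidableEq n] {V : Matrix n n ℝ} (hV : IsUnit V.det) (x : n → ℝ) :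
    (V + Matrix.vecMulVec x x).det = V.det * (1 + x ⬝ᵥ (V⁻¹ *ᵥ x)) := by
  rw [Matrix.vecMulVec_eq Unit, Matrix.det_add_replicateCol_mul_replicateRow hV, Matrix.det_unique (n := Unit),
    Matrix.add_apply, Matrix.one_apply_eq, Matrix.mul_assoc, ← Matrix.replicateCol_mulVec,
    Matrix.replicateRow_mul_replicateCol_apply]

/-- The arithmetic-geometric mean inequality for the eigenvalues. -/
theorem Matrix.PosDef.det_le_trace_div_pow [DecidableEq n] {V : Matrix n n ℝ} (hV : V.PosDef) [Nonempty n] :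
    V.det ≤ (V.trace / Fintype.card n) ^ Fintype.card n := by
  have hc : (0 : ℝ) < Fintype.card n := by exact_mod_cast Fintype.card_pos
  have h := Real.geom_mean_le_arith_mean_weighted Finset.univ
    (fun _ => (Fintype.card n : ℝ)⁻¹) hV.1.eigenvalues (fun _ _ => by positivity)
    (by simp [hc.ne']) fun i _ => (hV.eigenvalues_pos i).le
  have h2 := pow_le_pow_left₀ (Finset.prod_nonneg fun i _ =>
    Real.rpow_nonneg (hV.eigenvalues_pos i).le _) h (Fintype.card n)
  rw [← Finset.prod_pow, ← Finset.mul_sum] at h2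
  rw [hV.1.det_eq_prod_eigenvalues, hV.1.trace_eq_sum_eigenvalues, div_eq_inv_mul]
  refine le_of_eq_of_le (Finset.prod_congr rfl fun i _ => ?_) h2
  rw [Real.rpow_inv_natCast_pow (hV.eigenvalues_pos i).le Fintype.card_ne_zero]
  rfl

end LinearAlgebra

/-! ### Gaussian integrals -/

section GaussianIntegral

variable {n : Type*} [Fintype n]

theorem lintegral_exp_neg_dotProduct_self_ne_top :
    ∫⁻ φ : n → ℝ, ENNReal.ofReal (Real.exp (-(φ ⬝ᵥ φ) / 2)) ≠ ⊤ := by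
  have h : Integrable (fun φ : n → ℝ => ∏ i, Real.exp (-(1 / 2) * φ i ^ 2)) volume :=
    Integrable.fintype_prod fun _ => integrable_exp_neg_mul_sq (by norm_num)
  have h2 : (fun φ : n → ℝ => Real.exp (-(φ ⬝ᵥ φ) / 2)) =
      fun φ => ∏ i, Real.exp (-(1 / 2) * φ i ^ 2) := by
    ext φ
    rw [← Real.exp_sum, ← Finset.mul_sum]
    simp only [dotProduct, sq]
    ring_nf
  rw [← h2] at h
  exact (lintegral_ofReal_le_lintegral_enorm _).trans_lt h.2 |>.ne

theorem lintegral_exp_neg_dotProduct_self_ne_zero :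
    ∫⁻ φ : n → ℝ, ENNReal.ofReal (Real.exp (-(φ ⬝ᵥ φ) / 2)) ≠ 0 := by
  rw [← pos_iff_ne_zero, lintegral_pos_iff_support]
  · have : (Function.support fun φ : n → ℝ => ENNReal.ofReal (Real.exp (-(φ ⬝ᵥ φ) / 2))) =
        Set.univ := by
      ext φ
      simp [Real.exp_pos]
    rw [this]
    exact Measure.measure_univ_pos.mpr (NeZero.ne _)
  · simp only [dotProduct]
    fun_prop

/-- Completing the square and translation invariance. The Gaussian normalisation is kept as an
unevaluated integral: it cancels later, so only that it is finite and nonzero matters. -/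
theorem lintegral_exp_dotProduct_sub (u : n → ℝ) :
    ∫⁻ φ : n → ℝ, ENNReal.ofReal (Real.exp (φ ⬝ᵥ u - (φ ⬝ᵥ φ) / 2)) =
      ENNReal.ofReal (Real.exp ((u ⬝ᵥ u) / 2)) *
        ∫⁻ φ : n → ℝ, ENNReal.ofReal (Real.exp (-(φ ⬝ᵥ φ) / 2)) := by
  rw [← lintegral_sub_right_eq_self (fun φ : n → ℝ => ENNReal.ofReal (Real.exp (-(φ ⬝ᵥ φ) / 2))) u,
    ← lintegral_const_mul]
  · refine lintegral_congr fun φ => ?_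
    rw [← ENNReal.ofReal_mul (Real.exp_pos _).le, ← Real.exp_add]
    congr 2
    simp only [sub_dotProduct, dotProduct_sub, dotProduct_comm u φ]
    ring
  · simp only [dotProduct]
    fun_prop

/-- The Gaussian integral with linear term `S` and precision matrix `V`. -/
theorem Matrix.PosDef.lintegral_exp_dotProduct_sub [DecidableEq n] {V : Matrix n n ℝ} (hV : V.PosDef)
    (S : n → ℝ) :
    ∫⁻ φ : n → ℝ, ENNReal.ofReal (Real.exp (φ ⬝ᵥ S - (φ ⬝ᵥ (V *ᵥ φ)) / 2)) =
      ENNReal.ofReal ((√V.det)⁻¹ * Real.exp ((S ⬝ᵥ (V⁻¹ *ᵥ S)) / 2)) *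
        ∫⁻ φ : n → ℝ, ENNReal.ofReal (Real.exp (-(φ ⬝ᵥ φ) / 2)) := by
  obtain ⟨B, rfl, hB⟩ := hV.exists_transpose_mul_self
  rw [Matrix.dotProduct_inv_transpose_mul_self_mulVec, Matrix.det_mul, Matrix.det_transpose,
    Real.sqrt_mul_self_eq_abs, ENNReal.ofReal_mul (by positivity), mul_assoc,
    ← _root_.lintegral_exp_dotProduct_sub, ← abs_inv]
  -- The substitution `φ ↦ B φ` reduces to identity precision; its Jacobian supplies `|det B|⁻¹ =
  -- (√(det V))⁻¹`.
  have hmap := Real.map_matrix_volume_pi_eq_smul_volume_pi hB.ne_zero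
  rw [← smul_eq_mul (ENNReal.ofReal _), ← lintegral_smul_measure, ← hmap, lintegral_map]
  · refine lintegral_congr fun φ => ?_
    have : φ ⬝ᵥ S = (B *ᵥ φ) ⬝ᵥ ((B⁻¹)ᵀ *ᵥ S) := by
      rw [Matrix.dotProduct_mulVec, Matrix.vecMul_transpose, Matrix.mulVec_mulVec,
        Matrix.nonsing_inv_mul _ hB, Matrix.one_mulVec]
    rw [Matrix.dotProduct_transpose_mul_self_mulVec, this, Matrix.toLin'_apply]
  · simp only [dotProduct]
    fun_prop
  · exact (LinearMap.continuous_of_finiteDimensional _).measurable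

end GaussianIntegral

/-! ### Conditional expectations and sub-Gaussian exponentials -/

section CondExp

variable {Ω : Type*} {m mΩ : MeasurableSpace Ω} {P : Measure Ω}

/-- Taking out what is known, for nonnegative functions. -/
theorem lintegral_mul_ofReal_condExp [IsFiniteMeasure P] (hm : m ≤ mΩ) {Z : Ω → ℝ}
    (hZ : Integrable Z P) (hZ0 : 0 ≤ Z) {W : Ω → ENNReal} (hW : Measurable[m] W) :
    ∫⁻ ω, W ω * ENNReal.ofReal (Z ω) ∂P = ∫⁻ ω, W ω * ENNReal.ofReal (P[Z|m] ω) ∂P := by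
  have hW' : Measurable W := hW.mono hm le_rfl
  have hE0 : 0 ≤ᵐ[P] P[Z|m] := condExp_nonneg (Filter.Eventually.of_forall hZ0)
  -- The densities `Z` and `P[Z|m]` define measures that agree on `m`, hence integrate the
  -- `m`-measurable `W` equally.
  have key : (P.withDensity fun ω => ENNReal.ofReal (Z ω)).trim hm =
      (P.withDensity fun ω => ENNReal.ofReal (P[Z|m] ω)).trim hm := by
    refine @Measure.ext _ m _ _ fun s hs => ?_
    rw [trim_measurableSet_eq hm hs, trim_measurableSet_eq hm hs,
      withDensity_apply _ (hm s hs), withDensity_apply _ (hm s hs),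
      ← ofReal_integral_eq_lintegral_ofReal hZ.integrableOn
        (Filter.Eventually.of_forall hZ0),
      ← ofReal_integral_eq_lintegral_ofReal integrable_condExp.integrableOn
        (ae_restrict_of_ae hE0), setIntegral_condExp hm hZ hs]
  have aux : ∀ g : Ω → ℝ, Integrable g P → ∫⁻ ω, W ω * ENNReal.ofReal (g ω) ∂P =
      ∫⁻ ω, W ω ∂((P.withDensity fun ω => ENNReal.ofReal (g ω)).trim hm) := by
    intro g hg
    rw [lintegral_trim hm hW, lintegral_withDensity_eq_lintegral_mul₀
      hg.1.aemeasurable.ennreal_ofReal hW'.aemeasurable]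
    simp only [Pi.mul_apply, mul_comm]
  rw [aux Z hZ, aux _ integrable_condExp, key]

theorem IsCondSubGaussian.lintegral_mul_exp_const_le [IsFiniteMeasure P] (hm : m ≤ mΩ)
    {Y : Ω → ℝ} (hY : IsCondSubGaussian P m Y 1) (s : ℝ) {W : Ω → ENNReal}
    (hW : Measurable[m] W) :
    ∫⁻ ω, W ω * ENNReal.ofReal (Real.exp (s * Y ω - s ^ 2 / 2)) ∂P ≤ ∫⁻ ω, W ω ∂P := by
  have hc : Measurable[m] fun ω => W ω * ENNReal.ofReal (Real.exp (-(s ^ 2 / 2))) :=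
    Measurable.mul hW (@measurable_const _ _ _ m _)
  calc ∫⁻ ω, W ω * ENNReal.ofReal (Real.exp (s * Y ω - s ^ 2 / 2)) ∂P
      = ∫⁻ ω, W ω * ENNReal.ofReal (Real.exp (-(s ^ 2 / 2))) *
          ENNReal.ofReal (Real.exp (s * Y ω)) ∂P := by
        refine lintegral_congr fun ω => ?_
        rw [mul_assoc, ← ENNReal.ofReal_mul (Real.exp_pos _).le, ← Real.exp_add]
        ring_nf
    _ = ∫⁻ ω, W ω * ENNReal.ofReal (Real.exp (-(s ^ 2 / 2))) *
          ENNReal.ofReal (P[fun ω => Real.exp (s * Y ω)|m] ω) ∂P :=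
        lintegral_mul_ofReal_condExp hm (hY s).1 (fun ω => (Real.exp_pos _).le) hc
    _ ≤ ∫⁻ ω, W ω ∂P := by
        refine lintegral_mono_ae ?_
        filter_upwards [(hY s).2] with ω hω
        rw [mul_assoc, ← ENNReal.ofReal_mul (Real.exp_pos _).le]
        refine mul_le_of_le_one_right' (ENNReal.ofReal_le_one.mpr ?_)
        calc Real.exp (-(s ^ 2 / 2)) * P[fun ω => Real.exp (s * Y ω)|m] ω
            ≤ Real.exp (-(s ^ 2 / 2)) * Real.exp (1 ^ 2 * s ^ 2 / 2) := by gcongr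
          _ = 1 := by rw [← Real.exp_add]; ring_nf; exact Real.exp_zero

/-- On each of the finitely many level sets of `s` the factor is constant, and the indicator of the
level set is absorbed into `W`. -/
theorem IsCondSubGaussian.lintegral_mul_exp_simpleFunc_le [IsFiniteMeasure P] (hm : m ≤ mΩ)
    {Y : Ω → ℝ} (hYm : Measurable Y) (hY : IsCondSubGaussian P m Y 1) (s : @SimpleFunc Ω m ℝ)
    {W : Ω → ENNReal} (hW : Measurable[m] W) :
    ∫⁻ ω, W ω * ENNReal.ofReal (Real.exp (s ω * Y ω - s ω ^ 2 / 2)) ∂P ≤ ∫⁻ ω, W ω ∂P := by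
  have hs : ∀ c, MeasurableSet[m] (s ⁻¹' {c}) := fun c => @SimpleFunc.measurableSet_fiber _ _ m s c
  have split : ∀ G : Ω → ℝ → ENNReal, (∀ c, Measurable fun ω => G ω c) →
      ∫⁻ ω, G ω (s ω) ∂P =
        ∑ c ∈ @SimpleFunc.range Ω ℝ m s, ∫⁻ ω, (s ⁻¹' {c}).indicator (fun ω => G ω c) ω ∂P := by
    intro G hG
    rw [← lintegral_finsetSum _ fun c _ => (hG c).indicator (hm _ (hs c))]
    refine lintegral_congr fun ω => ?_
    rw [Finset.sum_eq_single (s ω)]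
    · rw [Set.indicator_of_mem (by simp)]
    · intro c _ hc
      exact Set.indicator_of_notMem (fun h => hc h.symm) _
    · intro h
      exact absurd (@SimpleFunc.mem_range_self _ _ m s ω) h
  have hW' : Measurable W := hW.mono hm le_rfl
  rw [split (fun ω c => W ω * ENNReal.ofReal (Real.exp (c * Y ω - c ^ 2 / 2)))
    (fun c => by fun_prop), split (fun ω _ => W ω) fun _ => hW']
  refine Finset.sum_le_sum fun c _ => ?_
  refine le_trans (le_of_eq (lintegral_congr fun ω => ?_))
    (hY.lintegral_mul_exp_const_le hm c (hW.indicator (hs c)))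
  by_cases h : ω ∈ s ⁻¹' {c} <;> simp [h]

/-- The exponential supermartingale inequality of a conditionally sub-Gaussian variable, scaled by
a random factor `s` that is known to `m`. -/
theorem IsCondSubGaussian.lintegral_mul_exp_le [IsFiniteMeasure P] (hm : m ≤ mΩ)
    {Y : Ω → ℝ} (hYm : Measurable Y) (hY : IsCondSubGaussian P m Y 1) {s : Ω → ℝ}
    (hs : Measurable[m] s) {W : Ω → ENNReal} (hW : Measurable[m] W) (hWtop : ∀ ω, W ω ≠ ⊤) :
    ∫⁻ ω, W ω * ENNReal.ofReal (Real.exp (s ω * Y ω - s ω ^ 2 / 2)) ∂P ≤ ∫⁻ ω, W ω ∂P := by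
  have hsm : StronglyMeasurable[m] s := hs.stronglyMeasurable
  have hW' : Measurable W := hW.mono hm le_rfl
  let F : ℕ → Ω → ENNReal := fun k ω => W ω *
    ENNReal.ofReal (Real.exp (hsm.approx k ω * Y ω - hsm.approx k ω ^ 2 / 2))
  have hF : ∀ k, Measurable (F k) := fun k => by
    have : Measurable (hsm.approx k : Ω → ℝ) :=
      Measurable.mono (@SimpleFunc.measurable _ _ m _ (hsm.approx k)) hm le_rfl
    fun_prop
  have hlim : ∀ ω, Filter.Tendsto (fun k => F k ω) Filter.atTop
      (nhds (W ω * ENNReal.ofReal (Real.exp (s ω * Y ω - s ω ^ 2 / 2)))) := fun ω => by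
    refine ENNReal.Tendsto.const_mul (ENNReal.tendsto_ofReal ?_) (Or.inr (hWtop ω))
    have := hsm.tendsto_approx ω
    exact (Real.continuous_exp.tendsto _).comp ((this.mul_const _).sub ((this.pow 2).div_const 2))
  -- Fatou's lemma passes from simple approximations to `s`, without any integrability of the limit.
  calc _ = ∫⁻ ω, Filter.liminf (fun k => F k ω) Filter.atTop ∂P :=
        lintegral_congr fun ω => (hlim ω).liminf_eq.symm
    _ ≤ Filter.liminf (fun k => ∫⁻ ω, F k ω ∂P) Filter.atTop := lintegral_liminf_le hF
    _ ≤ ∫⁻ ω, W ω ∂P := by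
        refine Filter.liminf_le_of_frequently_le' (Filter.Frequently.of_forall fun k => ?_)
        exact hY.lintegral_mul_exp_simpleFunc_le hm hYm _ hW

end CondExp

/-! ### Design matrix, elliptical potential and ridge estimate -/

namespace Interaction

variable {Ω : Type*} {d K : ℕ} (X : Interaction Ω d K)

theorem covMatrix_add_one {t : ℕ} (ht : 1 ≤ t) (ω : Ω) :
    X.covMatrix 1 (t + 1) ω = X.covMatrix 1 t ω +
      Matrix.vecMulVec (X.chosen t ω).ofLp (X.chosen t ω).ofLp := by
  rw [covMatrix, covMatrix, Finset.sum_Ico_succ_top ht, add_assoc]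

theorem covMatrix_mulVec (t : ℕ) (ω : Ω) (u : Fin d → ℝ) :
    X.covMatrix 1 t ω *ᵥ u =
      u + ∑ τ ∈ Finset.Ico 1 t, ((X.chosen τ ω).ofLp ⬝ᵥ u) • (X.chosen τ ω).ofLp := by
  rw [covMatrix, one_smul, Matrix.add_mulVec, Matrix.one_mulVec, Matrix.sum_mulVec]
  congr 1
  refine Finset.sum_congr rfl fun τ _ => ?_
  rw [Matrix.vecMulVec_mulVec]
  ext i
  simp [mul_comm]

theorem dotProduct_covMatrix_mulVec (t : ℕ) (ω : Ω) (u : Fin d → ℝ) :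
    u ⬝ᵥ (X.covMatrix 1 t ω *ᵥ u) =
      u ⬝ᵥ u + ∑ τ ∈ Finset.Ico 1 t, (u ⬝ᵥ (X.chosen τ ω).ofLp) ^ 2 := by
  rw [covMatrix_mulVec, dotProduct_add, dotProduct_sum]
  congr 1
  refine Finset.sum_congr rfl fun τ _ => ?_
  rw [dotProduct_smul, smul_eq_mul, sq, dotProduct_comm u]

theorem posDef_covMatrix (t : ℕ) (ω : Ω) : (X.covMatrix 1 t ω).PosDef := by
  rw [covMatrix, one_smul]
  refine Matrix.PosDef.one.add_posSemidef (Matrix.posSemidef_sum _ fun τ _ => ?_)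
  simpa using Matrix.posSemidef_vecMulVec_self_star (X.chosen τ ω).ofLp

theorem dotProduct_self_le_covMatrix (t : ℕ) (ω : Ω) (u : Fin d → ℝ) :
    u ⬝ᵥ u ≤ u ⬝ᵥ (X.covMatrix 1 t ω *ᵥ u) := by
  rw [dotProduct_covMatrix_mulVec]
  exact le_add_of_nonneg_right (Finset.sum_nonneg fun _ _ => sq_nonneg _)

theorem log_det_covMatrix_le (hd : 1 ≤ d) (T : ℕ) (ω : Ω)
    (hx : ∀ τ, 1 ≤ τ → (X.chosen τ ω).ofLp ⬝ᵥ (X.chosen τ ω).ofLp ≤ 1) :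
    Real.log (X.covMatrix 1 (T + 1) ω).det ≤ d * Real.log (1 + T / d) := by
  have : Nonempty (Fin d) := ⟨⟨0, hd⟩⟩
  have hd0 : (0 : ℝ) < d := by exact_mod_cast hd
  have hV := X.posDef_covMatrix (T + 1) ω
  have htr : (X.covMatrix 1 (T + 1) ω).trace ≤ d + T := by
    rw [covMatrix, one_smul, Matrix.trace_add, Matrix.trace_one, Matrix.trace_sum,
      Fintype.card_fin]
    gcongr
    calc ∑ τ ∈ Finset.Ico 1 (T + 1),
          (Matrix.vecMulVec (X.chosen τ ω).ofLp (X.chosen τ ω).ofLp).trace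
        ≤ ∑ τ ∈ Finset.Ico 1 (T + 1), 1 := by
          refine Finset.sum_le_sum fun τ hτ => ?_
          rw [Matrix.trace_vecMulVec]
          exact hx τ (Finset.mem_Ico.mp hτ).1
      _ = T := by simp
  have h := hV.det_le_trace_div_pow
  rw [Fintype.card_fin] at h
  rw [← Real.log_pow]
  refine Real.log_le_log hV.det_pos (h.trans (pow_le_pow_left₀ ?_ ?_ _))
  · exact div_nonneg hV.posSemidef.trace_nonneg hd0.le
  · rw [div_le_iff₀ hd0]
    have : (1 + (T : ℝ) / d) * d = d + T := by field_simp
    linarith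

/-- The norm of a context vector with respect to the inverse of `V_t`. -/
noncomputable def width (t : ℕ) (ω : Ω) (v : Vec d) : ℝ :=
  √(v.ofLp ⬝ᵥ ((X.covMatrix 1 t ω)⁻¹ *ᵥ v.ofLp))

theorem width_sq (t : ℕ) (ω : Ω) (v : Vec d) :
    X.width t ω v ^ 2 = v.ofLp ⬝ᵥ ((X.covMatrix 1 t ω)⁻¹ *ᵥ v.ofLp) :=
  Real.sq_sqrt ((X.posDef_covMatrix t ω).dotProduct_inv_mulVec_nonneg _)

theorem width_nonneg (t : ℕ) (ω : Ω) (v : Vec d) : 0 ≤ X.width t ω v := Real.sqrt_nonneg _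

theorem dotProduct_ofLp_self_le_one {v : Vec d} (hv : ‖v‖ ≤ 1) : v.ofLp ⬝ᵥ v.ofLp ≤ 1 := by
  have : v.ofLp ⬝ᵥ v.ofLp = ‖v‖ ^ 2 := by
    rw [EuclideanSpace.real_norm_sq_eq]
    simp [dotProduct, sq]
  rw [this]
  exact pow_le_one₀ (norm_nonneg v) hv

theorem width_le_one (t : ℕ) (ω : Ω) {v : Vec d} (hv : ‖v‖ ≤ 1) : X.width t ω v ≤ 1 :=
  Real.sqrt_le_one.mpr (((X.posDef_covMatrix t ω).dotProduct_inv_mulVec_le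
    (X.dotProduct_self_le_covMatrix t ω) _).trans (dotProduct_ofLp_self_le_one hv))

/-- Each round multiplies the determinant by one plus the squared width, and `V_1` is the identity,
so the logarithm telescopes. -/
theorem log_det_covMatrix_eq (T : ℕ) (ω : Ω) :
    Real.log (X.covMatrix 1 (T + 1) ω).det =
      ∑ t ∈ Finset.Icc 1 T, Real.log (1 + X.width t ω (X.chosen t ω) ^ 2) := by
  induction T with
  | zero => simp [covMatrix]
  | succ T ih =>
    have hdet := (X.posDef_covMatrix (T + 1) ω).det_pos
    rw [Finset.sum_Icc_succ_top (by omega), ← ih, X.covMatrix_add_one (by omega),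
      Matrix.det_add_vecMulVec_self (isUnit_iff_ne_zero.mpr hdet.ne'), ← width_sq,
      Real.log_mul hdet.ne' (by positivity)]

/-- The elliptical potential lemma. -/
theorem sum_width_sq_le (hd : 1 ≤ d) (T : ℕ) (ω : Ω)
    (hx : ∀ τ, 1 ≤ τ → ‖X.chosen τ ω‖ ≤ 1) :
    ∑ t ∈ Finset.Icc 1 T, X.width t ω (X.chosen t ω) ^ 2 ≤ 2 * (d * Real.log (1 + T / d)) := by
  refine le_trans ?_ (mul_le_mul_of_nonneg_left (X.log_det_covMatrix_le hd T ω fun τ hτ =>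
    dotProduct_ofLp_self_le_one (hx τ hτ)) zero_le_two)
  rw [log_det_covMatrix_eq, Finset.mul_sum]
  refine Finset.sum_le_sum fun t ht => ?_
  set w := X.width t ω (X.chosen t ω)
  have hw0 : 0 ≤ w := X.width_nonneg _ _ _
  have hw1 : w ≤ 1 := X.width_le_one _ _ (hx t (Finset.mem_Icc.mp ht).1)
  have hlog := Real.le_log_one_add_of_nonneg (sq_nonneg w)
  -- As `w ≤ 1`, this and `hlog` give `w² ≤ 2 log(1 + w²)`.
  have : w ^ 2 / 2 ≤ 2 * w ^ 2 / (w ^ 2 + 2) := by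
    rw [le_div_iff₀ (by positivity)]
    nlinarith [sq_nonneg w, pow_le_one₀ hw0 hw1 (n := 2)]
  linarith

variable (μstar : Vec d)

/-- The sum of the context vectors of the selected arms, weighted by the noise. -/
noncomputable def noiseSum (t : ℕ) (ω : Ω) : Fin d → ℝ :=
  ∑ τ ∈ Finset.Ico 1 t, X.noise μstar τ ω • (X.chosen τ ω).ofLp

theorem inner_eq_dotProduct (u v : Vec d) : inner ℝ u v = u.ofLp ⬝ᵥ v.ofLp := by
  rw [EuclideanSpace.inner_eq_star_dotProduct]
  simp [dotProduct_comm]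

theorem bVec_eq (t : ℕ) (ω : Ω) :
    (X.bVec t ω).ofLp = X.covMatrix 1 t ω *ᵥ μstar.ofLp - (μstar.ofLp - X.noiseSum μstar t ω) := by
  rw [covMatrix_mulVec, bVec, noiseSum, WithLp.ofLp_sum]
  have : ∑ τ ∈ Finset.Ico 1 t, (X.reward τ ω • X.chosen τ ω).ofLp =
      ∑ τ ∈ Finset.Ico 1 t, ((X.chosen τ ω).ofLp ⬝ᵥ μstar.ofLp) • (X.chosen τ ω).ofLp +
      ∑ τ ∈ Finset.Ico 1 t, X.noise μstar τ ω • (X.chosen τ ω).ofLp := by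
    rw [← Finset.sum_add_distrib]
    refine Finset.sum_congr rfl fun τ _ => ?_
    rw [← add_smul, noise, inner_eq_dotProduct, dotProduct_comm, add_sub_cancel, WithLp.ofLp_smul]
  rw [this]
  abel

/-- The estimation error of the ridge regression solution. -/
theorem sqrt_sub_ridge_le (hμ : ‖μstar‖ ≤ 1) (t : ℕ) (ω : Ω) :
    √(dotProduct (μstar - X.ridge 1 t ω).ofLp
      (Matrix.mulVec (X.covMatrix 1 t ω) (μstar - X.ridge 1 t ω).ofLp)) ≤
      1 + √(X.noiseSum μstar t ω ⬝ᵥ ((X.covMatrix 1 t ω)⁻¹ *ᵥ X.noiseSum μstar t ω)) := by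
  set V := X.covMatrix 1 t ω with hVdef
  set S := X.noiseSum μstar t ω
  have hV : V.PosDef := X.posDef_covMatrix t ω
  have hU : IsUnit V.det := isUnit_iff_ne_zero.mpr hV.det_pos.ne'
  -- The error splits into the bias of the unit regularisation, of size at most 1 since `‖μstar‖ ≤
  -- 1`, and the noise.
  have herr : (μstar - X.ridge 1 t ω).ofLp = V⁻¹ *ᵥ (μstar.ofLp - S) := by
    rw [WithLp.ofLp_sub, ridge, ← hVdef, bVec_eq X μstar, ← hVdef, Matrix.mulVec_sub _ (V *ᵥ _),
      Matrix.mulVec_mulVec, Matrix.nonsing_inv_mul _ hU, Matrix.one_mulVec]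
    exact sub_sub_cancel _ _
  rw [herr, Matrix.mulVec_mulVec, Matrix.mul_nonsing_inv _ hU, Matrix.one_mulVec,
    dotProduct_comm]
  refine (hV.inv.sqrt_dotProduct_mulVec_sub_le _ _).trans ?_
  gcongr
  exact X.width_le_one t ω hμ

/-- The parameters of the confidence region differ on a context vector by at most the width. -/
theorem abs_inner_sub_le {β : ℕ → ℝ} {t : ℕ} {ω : Ω} {θ θ' : Vec d}
    (hθ : θ ∈ X.confRegion 1 β t ω) (hθ' : θ' ∈ X.confRegion 1 β t ω) (v : Vec d) :
    |inner ℝ θ v - inner ℝ θ' v| ≤ 2 * √(β t) * X.width t ω v := by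
  have hV := X.posDef_covMatrix t ω
  rw [← inner_sub_left, inner_eq_dotProduct]
  refine (hV.abs_dotProduct_le _ _).trans (mul_le_mul_of_nonneg_right ?_ (X.width_nonneg t ω v))
  have h := hV.sqrt_dotProduct_mulVec_sub_le (θ - X.ridge 1 t ω).ofLp (θ' - X.ridge 1 t ω).ofLp
  rw [← WithLp.ofLp_sub, sub_sub_sub_cancel_right] at h
  have h1 : _ ≤ √(β t) := hθ
  have h2 : _ ≤ √(β t) := hθ'
  linarith

end Interaction

/-! ### Dependence of the fair policy on the parameter -/

theorem fairPolicy_nonneg {d K : ℕ} {f : ℝ → ℝ} (hf : ∀ y, 0 < f y) (θ : Vec d)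
    (x : Fin K → Vec d) (a : Fin K) : 0 ≤ fairPolicy f θ x a :=
  div_nonneg (hf _).le (Finset.sum_nonneg fun _ _ => (hf _).le)

/-- The inequality, unlike equality, also covers a vanishing denominator, where the quotient is 0 by
convention. -/
theorem sum_fairPolicy_le_one {d K : ℕ} (f : ℝ → ℝ) (θ : Vec d) (x : Fin K → Vec d) :
    ∑ a, fairPolicy f θ x a ≤ 1 := by
  simp only [fairPolicy]
  rw [← Finset.sum_div]
  exact div_self_le_one _

/-- The distance of two fair policies, in terms of the parameters. -/
theorem sum_abs_fairPolicy_sub_le {d K : ℕ} {f : ℝ → ℝ} {γ L : ℝ} (hγ : 0 < γ)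
    (hmin : ∀ y, γ ≤ f y) (hlip : ∀ y z, |f y - f z| ≤ L * |y - z|) (θ' θ : Vec d)
    (x : Fin K → Vec d) :
    ∑ a, |fairPolicy f θ' x a - fairPolicy f θ x a| ≤
      2 * L / γ * ∑ a, fairPolicy f θ x a * |inner ℝ θ' (x a) - inner ℝ θ (x a)| := by
  rcases isEmpty_or_nonempty (Fin K) with hK | hK
  · simp
  have hpos : ∀ y, 0 < f y := fun y => hγ.trans_le (hmin y)
  set A : Fin K → ℝ := fun a => f (inner ℝ θ' (x a)) with hA
  set B : Fin K → ℝ := fun a => f (inner ℝ θ (x a)) with hB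
  have hSA : 0 < ∑ a, A a := Finset.sum_pos (fun a _ => hpos _) Finset.univ_nonempty
  have hSB : 0 < ∑ a, B a := Finset.sum_pos (fun a _ => hpos _) Finset.univ_nonempty
  have hD : |∑ a, A a - ∑ a, B a| ≤ ∑ a, |A a - B a| := by
    rw [← Finset.sum_sub_distrib]
    exact Finset.abs_sum_le_sum_abs _ _
  have h1 : ∀ a, |A a / ∑ b, A b - B a / ∑ b, B b| ≤
      |A a - B a| / ∑ b, B b + A a / (∑ b, A b) * ((∑ b, |A b - B b|) / ∑ b, B b) := by
    intro a
    -- The weights `A a / ∑ A` sum to 1, so the change of normaliser costs no more than the change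
    -- of merits; this is the factor 2.
    have : A a / ∑ b, A b - B a / ∑ b, B b = (A a - B a) / ∑ b, B b -
        A a / (∑ b, A b) * ((∑ b, A b - ∑ b, B b) / ∑ b, B b) := by
      field_simp
      ring
    rw [this]
    refine (abs_sub _ _).trans (add_le_add ?_ ?_)
    · rw [abs_div, abs_of_pos hSB]
    · rw [abs_mul, abs_div _ (∑ b, B b), abs_of_pos hSB,
        abs_of_nonneg (div_nonneg (hpos _).le hSA.le)]
      exact mul_le_mul_of_nonneg_left (by gcongr) (div_nonneg (hpos _).le hSA.le)
  calc ∑ a, |fairPolicy f θ' x a - fairPolicy f θ x a|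
      ≤ ∑ a, (|A a - B a| / ∑ b, B b +
          A a / (∑ b, A b) * ((∑ b, |A b - B b|) / ∑ b, B b)) :=
        Finset.sum_le_sum fun a _ => h1 a
    _ = 2 * ∑ a, |A a - B a| / ∑ b, B b := by
        rw [Finset.sum_add_distrib, ← Finset.sum_mul, ← Finset.sum_div, ← Finset.sum_div,
          div_self hSA.ne', two_mul, one_mul]
    _ ≤ 2 * ∑ a, L / γ * (fairPolicy f θ x a * |inner ℝ θ' (x a) - inner ℝ θ (x a)|) := by
        refine mul_le_mul_of_nonneg_left (Finset.sum_le_sum fun a _ => ?_) zero_le_two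
        have h2 : |A a - B a| ≤ L * |inner ℝ θ' (x a) - inner ℝ θ (x a)| := hlip _ _
        -- Inserting this factor turns the plain sum over arms into an average under the policy of
        -- `θ`.
        have h3 : 1 ≤ B a / γ := (one_le_div hγ).mpr (hmin _)
        calc |A a - B a| / ∑ b, B b ≤ B a / γ * |A a - B a| / ∑ b, B b := by
              gcongr
              exact le_mul_of_one_le_left (abs_nonneg _) h3
          _ ≤ B a / γ * (L * |inner ℝ θ' (x a) - inner ℝ θ (x a)|) / ∑ b, B b := by
              gcongr
          _ = _ := by
              simp only [fairPolicy, hB]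
              ring
    _ = _ := by rw [← Finset.mul_sum]; ring

/-! ### Measurability of determinants, coordinates and selected entries -/

section Measurability

variable {Ω : Type*} {m : MeasurableSpace Ω} {d K : ℕ}

theorem Measurable.matrix_det {n : Type*} [Fintype n] [DecidableEq n] {A : Ω → Matrix n n ℝ}
    (hA : ∀ i j, Measurable fun ω => A ω i j) : Measurable fun ω => (A ω).det := by
  simp only [Matrix.det_apply']
  exact Finset.measurable_sum _ fun σ _ =>
    (Finset.measurable_prod _ fun i _ => hA _ _).const_mul _

theorem Measurable.vec_ofLp_apply {v : Ω → Vec d} (hv : Measurable v) (i : Fin d) :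
    Measurable fun ω => (v ω).ofLp i :=
  (EuclideanSpace.proj (𝕜 := ℝ) i).continuous.measurable.comp hv

theorem Measurable.apply_fin {E : Type*} [MeasurableSpace E] {x : Ω → Fin K → E} {k : Ω → Fin K}
    (hx : ∀ a, Measurable fun ω => x ω a) (hk : Measurable k) :
    Measurable fun ω => x ω (k ω) := by
  have : Measurable fun p : Ω × Fin K => x p.1 p.2 := measurable_from_prod_countable_left hx
  exact this.comp (measurable_id.prodMk hk)

end Measurability

/-! ### Self-normalised tail bound by the method of mixtures -/

namespace Interaction

variable {Ω : Type*} {d K : ℕ} {mΩ : MeasurableSpace Ω} {X : Interaction Ω d K} {P : Measure Ω}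
  {ℱ : Filtration ℕ mΩ} {μstar : Vec d}

theorem preReward_le (hX : X.IsLinearBandit P ℱ μstar) {t : ℕ} (ht : 1 ≤ t) :
    X.preReward ℱ t ≤ ℱ (t + 1) :=
  sup_le (ℱ.mono (Nat.le_succ t)) (hX.arm_meas t ht).comap_le

theorem measurable_chosen (hX : X.IsLinearBandit P ℱ μstar) {t : ℕ} (ht : 1 ≤ t) :
    Measurable[X.preReward ℱ t] (X.chosen t) := by
  refine Measurable.apply_fin (m := X.preReward ℱ t) (x := X.context t) (k := X.arm t)
    (fun a => (hX.context_meas t ht a).mono le_sup_left le_rfl) ?_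
  exact Measurable.mono (comap_measurable (X.arm t)) le_sup_right le_rfl

theorem measurable_chosen_of_lt (hX : X.IsLinearBandit P ℱ μstar) {t s : ℕ} (ht : 1 ≤ t)
    (hts : t < s) : Measurable[ℱ s] (X.chosen t) :=
  (measurable_chosen hX ht).mono ((preReward_le hX ht).trans (ℱ.mono hts)) le_rfl

theorem measurable_noise_of_lt (hX : X.IsLinearBandit P ℱ μstar) {t s : ℕ} (ht : 1 ≤ t)
    (hts : t < s) : Measurable[ℱ s] (X.noise μstar t) := by
  have h1 : Measurable[ℱ s] (X.reward t) := (hX.reward_meas t ht).mono (ℱ.mono hts) le_rfl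
  have h2 : Measurable[ℱ s] (X.chosen t) := measurable_chosen_of_lt hX ht hts
  exact h1.sub (measurable_const.inner h2)

theorem measurable_covMatrix_apply (hX : X.IsLinearBandit P ℱ μstar) (t : ℕ) (i j : Fin d) :
    Measurable[ℱ t] fun ω => X.covMatrix 1 t ω i j := by
  simp only [covMatrix, Matrix.add_apply, Matrix.sum_apply, Matrix.vecMulVec_apply]
  refine measurable_const.add (Finset.measurable_sum _ fun τ hτ => ?_)
  obtain ⟨h1, h2⟩ := Finset.mem_Ico.mp hτ
  have h := measurable_chosen_of_lt hX h1 h2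
  exact (h.vec_ofLp_apply i).mul (h.vec_ofLp_apply j)

theorem measurable_width (hX : X.IsLinearBandit P ℱ μstar) {t : ℕ} {v : Ω → Vec d}
    (hv : Measurable[ℱ t] v) : Measurable[ℱ t] fun ω => X.width t ω (v ω) := by
  -- The determinant lemma expresses the width by determinants, polynomials in the entries, so
  -- measurability of a matrix inverse is not needed.
  have h : ∀ ω, X.width t ω (v ω) =
      √((X.covMatrix 1 t ω + Matrix.vecMulVec (v ω).ofLp (v ω).ofLp).det /
        (X.covMatrix 1 t ω).det - 1) := fun ω => by
    have hdet := (X.posDef_covMatrix t ω).det_pos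
    rw [Matrix.det_add_vecMulVec_self (isUnit_iff_ne_zero.mpr hdet.ne'),
      mul_div_cancel_left₀ _ hdet.ne', add_sub_cancel_left, width]
  simp only [h]
  have hV := measurable_covMatrix_apply hX t
  refine Measurable.sqrt (((Measurable.matrix_det fun i j => ?_).div
    (Measurable.matrix_det hV)).sub measurable_const)
  simp only [Matrix.add_apply, Matrix.vecMulVec_apply]
  exact (hV i j).add ((hv.vec_ofLp_apply i).mul (hv.vec_ofLp_apply j))

theorem measurable_fairPolicy {m : MeasurableSpace Ω} {f : ℝ → ℝ} (hf : Measurable f)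
    {θ : Ω → Vec d} {x : Ω → Fin K → Vec d} (hθ : Measurable θ)
    (hx : ∀ a, Measurable fun ω => x ω a) (a : Fin K) :
    Measurable fun ω => fairPolicy f (θ ω) (x ω) a := by
  simp only [fairPolicy]
  exact (hf.comp (hθ.inner (hx a))).div
    (Finset.measurable_sum _ fun b _ => hf.comp (hθ.inner (hx b)))

/-- The exponent of the exponential supermartingale of a direction `θ`. -/
noncomputable def logMixand (X : Interaction Ω d K) (μstar : Vec d) (θ : Fin d → ℝ) (t : ℕ)
    (ω : Ω) : ℝ :=
  ∑ τ ∈ Finset.Ico 1 t, ((θ ⬝ᵥ (X.chosen τ ω).ofLp) * X.noise μstar τ ω -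
    (θ ⬝ᵥ (X.chosen τ ω).ofLp) ^ 2 / 2)

/-- The Gaussian prior contributes exactly the identity term of `V_t`, so the mixture is a Gaussian
integral of precision `V_t`. -/
theorem logMixand_sub (θ : Fin d → ℝ) (t : ℕ) (ω : Ω) :
    X.logMixand μstar θ t ω - (θ ⬝ᵥ θ) / 2 =
      θ ⬝ᵥ X.noiseSum μstar t ω - (θ ⬝ᵥ (X.covMatrix 1 t ω *ᵥ θ)) / 2 := by
  rw [logMixand, dotProduct_covMatrix_mulVec, noiseSum, dotProduct_sum, Finset.sum_sub_distrib,
    ← Finset.sum_div]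
  simp only [dotProduct_smul, smul_eq_mul, mul_comm]
  ring

theorem measurable_dotProduct_chosen (hX : X.IsLinearBandit P ℱ μstar) (θ : Fin d → ℝ) {t : ℕ}
    (ht : 1 ≤ t) : Measurable[X.preReward ℱ t] fun ω => θ ⬝ᵥ (X.chosen t ω).ofLp := by
  simp only [dotProduct]
  exact Finset.measurable_sum _ fun i _ =>
    ((measurable_chosen hX ht).vec_ofLp_apply i).const_mul _

theorem measurable_logMixand (hX : X.IsLinearBandit P ℱ μstar) (θ : Fin d → ℝ) (t : ℕ) :
    Measurable[ℱ t] (X.logMixand μstar θ t) := by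
  refine Finset.measurable_sum _ fun τ hτ => ?_
  obtain ⟨h1, h2⟩ := Finset.mem_Ico.mp hτ
  have h : Measurable[ℱ t] fun ω => θ ⬝ᵥ (X.chosen τ ω).ofLp :=
    (measurable_dotProduct_chosen hX θ h1).mono ((preReward_le hX h1).trans (ℱ.mono h2)) le_rfl
  exact (h.mul (measurable_noise_of_lt hX h1 h2)).sub ((h.pow_const 2).div_const 2)

theorem lintegral_exp_logMixand_le_one [IsProbabilityMeasure P]
    (hX : X.IsLinearBandit P ℱ μstar)
    (hsub : ∀ t, 1 ≤ t → IsCondSubGaussian P (X.preReward ℱ t) (X.noise μstar t) 1)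
    (θ : Fin d → ℝ) {t : ℕ} (ht : 1 ≤ t) :
    ∫⁻ ω, ENNReal.ofReal (Real.exp (X.logMixand μstar θ t ω)) ∂P ≤ 1 := by
  induction t, ht using Nat.le_induction with
  | base => simp [logMixand]
  | succ t ht ih =>
    have hpre := preReward_le hX ht
    refine le_trans (le_of_eq (lintegral_congr fun ω => ?_))
      (((hsub t ht).lintegral_mul_exp_le (hpre.trans (ℱ.le _))
        ((measurable_noise_of_lt hX ht t.lt_succ_self).mono (ℱ.le _) le_rfl)
        (measurable_dotProduct_chosen hX θ ht)
        (W := fun ω => ENNReal.ofReal (Real.exp (X.logMixand μstar θ t ω)))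
        ?_ fun ω => ENNReal.ofReal_ne_top).trans ih)
    · rw [← ENNReal.ofReal_mul (Real.exp_pos _).le, ← Real.exp_add, logMixand,
        Finset.sum_Ico_succ_top ht, logMixand]
    · exact (Real.measurable_exp.comp ((measurable_logMixand hX θ t).mono
        (le_sup_left : ℱ t ≤ X.preReward ℱ t) le_rfl)).ennreal_ofReal

theorem measurable_logMixand_uncurry (hX : X.IsLinearBandit P ℱ μstar) (t : ℕ) :
    Measurable fun p : Ω × (Fin d → ℝ) => X.logMixand μstar p.2 t p.1 := by
  refine Finset.measurable_sum _ fun τ hτ => ?_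
  obtain ⟨h1, h2⟩ := Finset.mem_Ico.mp hτ
  have hc : Measurable (X.chosen τ) := (measurable_chosen_of_lt hX h1 h2).mono (ℱ.le _) le_rfl
  have hn : Measurable (X.noise μstar τ) :=
    (measurable_noise_of_lt hX h1 h2).mono (ℱ.le _) le_rfl
  have h : Measurable fun p : Ω × (Fin d → ℝ) => p.2 ⬝ᵥ (X.chosen τ p.1).ofLp := by
    simp only [dotProduct]
    exact Finset.measurable_sum _ fun i _ => ((measurable_pi_apply i).comp measurable_snd).mul
      ((hc.vec_ofLp_apply i).comp measurable_fst)
  exact (h.mul (hn.comp measurable_fst)).sub ((h.pow_const 2).div_const 2)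

/-- The self-normalised tail bound at a fixed round. -/
theorem measure_noiseSum_gt_le [IsProbabilityMeasure P] (hX : X.IsLinearBandit P ℱ μstar)
    (hsub : ∀ t, 1 ≤ t → IsCondSubGaussian P (X.preReward ℱ t) (X.noise μstar t) 1)
    {t : ℕ} (ht : 1 ≤ t) {ε : ℝ} (hε : 0 < ε) :
    P {ω | Real.log (X.covMatrix 1 t ω).det + 2 * Real.log (1 / ε) <
      X.noiseSum μstar t ω ⬝ᵥ ((X.covMatrix 1 t ω)⁻¹ *ᵥ X.noiseSum μstar t ω)} ≤
      ENNReal.ofReal ε := by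
  set Z : ENNReal := ∫⁻ φ : Fin d → ℝ, ENNReal.ofReal (Real.exp (-(φ ⬝ᵥ φ) / 2)) with hZ
  have hZ0 : Z ≠ 0 := lintegral_exp_neg_dotProduct_self_ne_zero
  have hZt : Z ≠ ⊤ := lintegral_exp_neg_dotProduct_self_ne_top
  let F : Ω → (Fin d → ℝ) → ENNReal := fun ω θ =>
    ENNReal.ofReal (Real.exp (X.logMixand μstar θ t ω - (θ ⬝ᵥ θ) / 2))
  have hFm : Measurable (Function.uncurry F) := by
    have h := measurable_logMixand_uncurry (X := X) hX t
    have h2 : Measurable fun p : Ω × (Fin d → ℝ) => p.2 ⬝ᵥ p.2 := by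
      simp only [dotProduct]
      fun_prop
    exact (Real.measurable_exp.comp (h.sub (h2.div_const 2))).ennreal_ofReal
  have hint : ∫⁻ ω, (∫⁻ θ, F ω θ) ∂P ≤ Z := by
    -- Tonelli: for each fixed direction the expectation is at most 1, leaving the prior mass `Z`.
    rw [lintegral_lintegral_swap hFm.aemeasurable]
    refine lintegral_mono fun θ => ?_
    have hm : Measurable fun ω => ENNReal.ofReal (Real.exp (X.logMixand μstar θ t ω)) :=
      (Real.measurable_exp.comp ((measurable_logMixand hX θ t).mono (ℱ.le _)
        le_rfl)).ennreal_ofReal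
    calc ∫⁻ ω, F ω θ ∂P
        = ∫⁻ ω, ENNReal.ofReal (Real.exp (-(θ ⬝ᵥ θ) / 2)) *
            ENNReal.ofReal (Real.exp (X.logMixand μstar θ t ω)) ∂P := by
          refine lintegral_congr fun ω => ?_
          rw [← ENNReal.ofReal_mul (Real.exp_pos _).le, ← Real.exp_add]
          simp only [F]
          congr 2
          ring
      _ = ENNReal.ofReal (Real.exp (-(θ ⬝ᵥ θ) / 2)) *
            ∫⁻ ω, ENNReal.ofReal (Real.exp (X.logMixand μstar θ t ω)) ∂P :=
          lintegral_const_mul _ hm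
      _ ≤ _ := mul_le_of_le_one_right' (lintegral_exp_logMixand_le_one hX hsub θ ht)
  have hF : ∀ ω, ∫⁻ θ, F ω θ = ENNReal.ofReal ((√(X.covMatrix 1 t ω).det)⁻¹ *
      Real.exp ((X.noiseSum μstar t ω ⬝ᵥ
        ((X.covMatrix 1 t ω)⁻¹ *ᵥ X.noiseSum μstar t ω)) / 2)) * Z := fun ω => by
    rw [hZ, ← (X.posDef_covMatrix t ω).lintegral_exp_dotProduct_sub]
    refine lintegral_congr fun θ => ?_
    simp only [F, logMixand_sub]
  have hmarkov : ENNReal.ofReal (1 / ε) * Z *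
      P {ω | ENNReal.ofReal (1 / ε) * Z ≤ ∫⁻ θ, F ω θ} ≤ ∫⁻ ω, (∫⁻ θ, F ω θ) ∂P :=
    mul_meas_ge_le_lintegral hFm.lintegral_prod_right' _
  have hsubset : {ω | Real.log (X.covMatrix 1 t ω).det + 2 * Real.log (1 / ε) <
      X.noiseSum μstar t ω ⬝ᵥ ((X.covMatrix 1 t ω)⁻¹ *ᵥ X.noiseSum μstar t ω)} ⊆
      {ω | ENNReal.ofReal (1 / ε) * Z ≤ ∫⁻ θ, F ω θ} := by
    intro ω hω
    have hdet := (X.posDef_covMatrix t ω).det_pos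
    simp only [Set.mem_ofPred_eq] at hω ⊢
    rw [hF ω]
    gcongr
    rw [← Real.exp_log (inv_pos.mpr (Real.sqrt_pos.mpr hdet)), ← Real.exp_add,
      ← Real.log_le_iff_le_exp (by positivity), Real.log_inv, Real.log_sqrt hdet.le]
    linarith
  have hP : ENNReal.ofReal (1 / ε) * P {ω | ENNReal.ofReal (1 / ε) * Z ≤ ∫⁻ θ, F ω θ} ≤ 1 := by
    rw [← ENNReal.mul_le_mul_iff_left hZ0 hZt, one_mul, mul_right_comm]
    exact hmarkov.trans hint
  refine (measure_mono hsubset).trans ?_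
  rw [one_div, ENNReal.ofReal_inv_of_pos hε, mul_comm, ← div_eq_mul_inv] at hP
  rw [ENNReal.div_le_iff_le_mul (Or.inl (by simpa using hε)) (Or.inl ENNReal.ofReal_ne_top),
    one_mul] at hP
  simpa only [one_div, ENNReal.ofReal_inv_of_pos hε] using hP

end Interaction

/-! ### Expected against realised values of a bounded function of the arm -/

theorem Real.exp_neg_le_one_sub_half {y : ℝ} (h0 : 0 ≤ y) (h1 : y ≤ 1) :
    Real.exp (-y) ≤ 1 - y / 2 := by
  have h : Real.exp (-y) ≤ 1 / (1 + y) := by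
    rw [Real.exp_neg, ← one_div]
    exact one_div_le_one_div_of_le (by linarith) (by linarith [Real.add_one_le_exp y])
  -- `(1 + y)(1 - y/2) - 1 = y(1 - y)/2 ≥ 0` on `[0,1]`.
  refine h.trans ((div_le_iff₀ (by linarith)).mpr ?_)
  nlinarith

/-- The mean of a `[0,1]`-valued function of a random arm is at most twice its realisation, in
exponential moments. -/
theorem lintegral_mul_exp_half_mean_sub_le {Ω : Type*} {m mΩ : MeasurableSpace Ω} {P : Measure Ω}
    [IsFiniteMeasure P] (hm : m ≤ mΩ) {K : ℕ} {k : Ω → Fin K} (hk : Measurable k)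
    {p g : Ω → Fin K → ℝ} (hp : ∀ a, Measurable[m] fun ω => p ω a)
    (hg : ∀ a, Measurable[m] fun ω => g ω a) (hp0 : ∀ ω a, 0 ≤ p ω a)
    (hp1 : ∀ ω, ∑ a, p ω a ≤ 1) (hg0 : ∀ ω a, 0 ≤ g ω a) (hg1 : ∀ ω a, g ω a ≤ 1)
    (hlaw : ∀ a, P[Set.indicator {ω | k ω = a} (fun _ => (1 : ℝ)) | m] =ᵐ[P] fun ω => p ω a)
    {W : Ω → ENNReal} (hW : Measurable[m] W) :
    ∫⁻ ω, W ω * ENNReal.ofReal (Real.exp ((∑ a, p ω a * g ω a) / 2 - g ω (k ω))) ∂P ≤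
      ∫⁻ ω, W ω ∂P := by
  let h : Fin K → Ω → ENNReal := fun a ω =>
    W ω * ENNReal.ofReal (Real.exp ((∑ b, p ω b * g ω b) / 2 - g ω a))
  have hh : ∀ a, Measurable[m] (h a) := fun a =>
    hW.mul (Real.measurable_exp.comp (((Finset.measurable_sum _ fun b _ =>
      (hp b).mul (hg b)).div_const 2).sub (hg a))).ennreal_ofReal
  have hs : ∀ a, MeasurableSet {ω | k ω = a} := fun a => hk (measurableSet_singleton a)
  have hi : ∀ a, Integrable (Set.indicator {ω | k ω = a} (fun _ => (1 : ℝ))) P := fun a =>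
    (integrable_const 1).indicator (hs a)
  calc ∫⁻ ω, W ω * ENNReal.ofReal (Real.exp ((∑ a, p ω a * g ω a) / 2 - g ω (k ω))) ∂P
      -- Splitting by the value of the arm leaves an `m`-measurable factor times an indicator, whose
      -- conditional expectation is `p`.
      = ∫⁻ ω, ∑ a, h a ω *
          ENNReal.ofReal (Set.indicator {ω | k ω = a} (fun _ => (1 : ℝ)) ω) ∂P := by
        refine lintegral_congr fun ω => ?_
        refine (Eq.trans (Finset.sum_eq_single (k ω) ?_ ?_) ?_).symm
        · intro a _ ha
          rw [Set.indicator_of_notMem (s := {ω | k ω = a}) fun h => ha h.symm]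
          simp
        · simp
        · simp [h]
    _ = ∑ a, ∫⁻ ω, h a ω *
          ENNReal.ofReal (Set.indicator {ω | k ω = a} (fun _ => (1 : ℝ)) ω) ∂P :=
        lintegral_finsetSum _ fun a _ => ((hh a).mono hm le_rfl).mul
          (measurable_const.indicator (hs a)).ennreal_ofReal
    _ = ∑ a, ∫⁻ ω, h a ω * ENNReal.ofReal (p ω a) ∂P := by
        refine Finset.sum_congr rfl fun a _ => ?_
        rw [lintegral_mul_ofReal_condExp hm (hi a)
          (Set.indicator_nonneg fun _ _ => zero_le_one) (hh a)]
        refine lintegral_congr_ae ?_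
        filter_upwards [hlaw a] with ω hω
        rw [hω]
    _ = ∫⁻ ω, ∑ a, h a ω * ENNReal.ofReal (p ω a) ∂P :=
        (lintegral_finsetSum _ fun a _ => ((hh a).mono hm le_rfl).mul
          ((hp a).mono hm le_rfl).ennreal_ofReal).symm
    _ ≤ ∫⁻ ω, W ω ∂P := by
        refine lintegral_mono fun ω => ?_
        simp only [h, mul_assoc]
        rw [← Finset.mul_sum]
        refine mul_le_of_le_one_right' ?_
        simp only [← ENNReal.ofReal_mul (Real.exp_pos _).le]
        rw [← ENNReal.ofReal_sum_of_nonneg fun a _ =>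
          mul_nonneg (Real.exp_pos _).le (hp0 ω a), ENNReal.ofReal_le_one]
        set M := ∑ b, p ω b * g ω b
        calc ∑ a, Real.exp (M / 2 - g ω a) * p ω a
            = Real.exp (M / 2) * ∑ a, Real.exp (-g ω a) * p ω a := by
              rw [Finset.mul_sum]
              refine Finset.sum_congr rfl fun a _ => ?_
              rw [← mul_assoc, ← Real.exp_add, sub_eq_add_neg]
          _ ≤ Real.exp (M / 2) * ∑ a, (1 - g ω a / 2) * p ω a := by
              gcongr with a
              · exact hp0 ω a
              · exact Real.exp_neg_le_one_sub_half (hg0 ω a) (hg1 ω a)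
          _ = Real.exp (M / 2) * (∑ a, p ω a - M / 2) := by
              congr 1
              rw [Finset.sum_div, ← Finset.sum_sub_distrib]
              exact Finset.sum_congr rfl fun a _ => by ring
          _ ≤ Real.exp (M / 2) * Real.exp (-(M / 2)) := by
              gcongr
              linarith [hp1 ω, Real.one_sub_le_exp_neg (M / 2)]
          _ = 1 := by rw [← Real.exp_add, add_neg_cancel, Real.exp_zero]

/-! ### Sum of expected widths, and the confidence event -/

namespace Interaction

variable {Ω : Type*} {d K : ℕ} {mΩ : MeasurableSpace Ω} {X : Interaction Ω d K} {P : Measure Ω}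
  {ℱ : Filtration ℕ mΩ} {μstar : Vec d} {f : ℝ → ℝ} {β : ℕ → ℝ}

/-- The expected width of the context vector of round `t`, given the learner's information. -/
noncomputable def meanWidth (X : Interaction Ω d K) (f : ℝ → ℝ) (t : ℕ) (ω : Ω) : ℝ :=
  ∑ a, X.policy f t ω a * X.width t ω (X.context t ω a)

theorem measurable_policy (hX : X.IsLinearBandit P ℱ μstar)
    (hA : X.IsFairXLinUCB P ℱ β f 1) (hf : Measurable f) {t : ℕ} (ht : 1 ≤ t) (a : Fin K) :
    Measurable[ℱ t] fun ω => X.policy f t ω a :=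
  measurable_fairPolicy (m := ℱ t) hf (hA.param_meas t ht) (hX.context_meas t ht) a

theorem measurable_sum_meanWidth_sub_width (hX : X.IsLinearBandit P ℱ μstar)
    (hA : X.IsFairXLinUCB P ℱ β f 1) (hf : Measurable f) (T : ℕ) :
    Measurable[ℱ (T + 1)] fun ω => ∑ t ∈ Finset.Icc 1 T,
      (X.meanWidth f t ω / 2 - X.width t ω (X.chosen t ω)) := by
  have hw : ∀ t, 1 ≤ t → ∀ a, Measurable[ℱ t] fun ω => X.width t ω (X.context t ω a) :=
    fun t ht a => measurable_width hX (hX.context_meas t ht a)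
  refine Finset.measurable_sum _ fun t ht => ?_
  obtain ⟨h1, h2⟩ := Finset.mem_Icc.mp ht
  have h3 : t < T + 1 := Nat.lt_succ_of_le h2
  have hmean : Measurable[ℱ (T + 1)] (X.meanWidth f t) :=
    Measurable.mono (Finset.measurable_sum _ fun a _ =>
      (measurable_policy hX hA hf h1 a).mul (hw t h1 a)) (ℱ.mono h3.le) le_rfl
  have hch : Measurable[ℱ (T + 1)] fun ω => X.width t ω (X.chosen t ω) :=
    Measurable.apply_fin (m := ℱ (T + 1)) (x := fun ω a => X.width t ω (X.context t ω a))
      (fun a => (hw t h1 a).mono (ℱ.mono h3.le) le_rfl)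
      ((hX.arm_meas t h1).mono (ℱ.mono h3) le_rfl)
  exact (hmean.div_const 2).sub hch

theorem lintegral_exp_meanWidth_sub_width_le [IsProbabilityMeasure P]
    (hX : X.IsLinearBandit P ℱ μstar) (hA : X.IsFairXLinUCB P ℱ β f 1) (hf : Measurable f)
    (hf0 : ∀ y, 0 < f y) (hctx : ∀ t, 1 ≤ t → ∀ ω a, ‖X.context t ω a‖ ≤ 1) (T : ℕ) :
    ∫⁻ ω, ENNReal.ofReal (Real.exp (∑ t ∈ Finset.Icc 1 T,
      (X.meanWidth f t ω / 2 - X.width t ω (X.chosen t ω)))) ∂P ≤ 1 := by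
  induction T with
  | zero => simp
  | succ T ih =>
    have ht : 1 ≤ T + 1 := Nat.le_add_left 1 T
    refine le_trans (le_of_eq (lintegral_congr fun ω => ?_))
      ((lintegral_mul_exp_half_mean_sub_le (ℱ.le (T + 1)) ((hX.arm_meas _ ht).mono (ℱ.le _) le_rfl)
        (measurable_policy hX hA hf ht)
        (fun a => measurable_width hX (hX.context_meas _ ht a)) (fun ω a => fairPolicy_nonneg hf0 _ _ _)
        (fun ω => sum_fairPolicy_le_one _ _ _) (fun ω a => X.width_nonneg _ _ _)
        (fun ω a => X.width_le_one _ _ (hctx _ ht ω a)) (hA.arm_law _ ht)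
        (W := fun ω => ENNReal.ofReal (Real.exp (∑ t ∈ Finset.Icc 1 T,
          (X.meanWidth f t ω / 2 - X.width t ω (X.chosen t ω))))) ?_).trans ih)
    · rw [← ENNReal.ofReal_mul (Real.exp_pos _).le, ← Real.exp_add,
        Finset.sum_Icc_succ_top ht]
      rfl
    · exact (Real.measurable_exp.comp
        (measurable_sum_meanWidth_sub_width hX hA hf T)).ennreal_ofReal

theorem measure_sum_meanWidth_gt_le [IsProbabilityMeasure P]
    (hX : X.IsLinearBandit P ℱ μstar) (hA : X.IsFairXLinUCB P ℱ β f 1) (hf : Measurable f)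
    (hf0 : ∀ y, 0 < f y) (hctx : ∀ t, 1 ≤ t → ∀ ω a, ‖X.context t ω a‖ ≤ 1) (T : ℕ)
    {ε : ℝ} (hε : 0 < ε) :
    P {ω | 2 * ∑ t ∈ Finset.Icc 1 T, X.width t ω (X.chosen t ω) + 2 * Real.log (1 / ε) <
      ∑ t ∈ Finset.Icc 1 T, X.meanWidth f t ω} ≤ ENNReal.ofReal ε := by
  have hmeas : Measurable fun ω => ENNReal.ofReal (Real.exp (∑ t ∈ Finset.Icc 1 T,
      (X.meanWidth f t ω / 2 - X.width t ω (X.chosen t ω)))) :=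
    (Real.measurable_exp.comp ((measurable_sum_meanWidth_sub_width hX hA hf T).mono (ℱ.le _)
      le_rfl)).ennreal_ofReal
  have hmarkov := (mul_meas_ge_le_lintegral (μ := P) hmeas (ENNReal.ofReal (1 / ε))).trans
    (lintegral_exp_meanWidth_sub_width_le hX hA hf hf0 hctx T)
  rw [one_div, ENNReal.ofReal_inv_of_pos hε, mul_comm, ← div_eq_mul_inv,
    ENNReal.div_le_iff_le_mul (Or.inl (by simpa using hε)) (Or.inl ENNReal.ofReal_ne_top),
    one_mul] at hmarkov
  refine (measure_mono fun ω hω => ?_).trans hmarkov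
  rw [Set.mem_ofPred_eq] at hω ⊢
  rw [← ENNReal.ofReal_inv_of_pos hε]
  refine ENNReal.ofReal_le_ofReal ?_
  rw [← Real.log_le_iff_le_exp (by positivity), Finset.sum_sub_distrib, ← Finset.sum_div]
  rw [one_div] at hω
  linarith

/-- With high probability `μstar` belongs to the confidence regions of all rounds. -/
theorem measure_notMem_confRegion_le [IsProbabilityMeasure P] (hd : 1 ≤ d)
    (hX : X.IsLinearBandit P ℱ μstar) (hμ : ‖μstar‖ ≤ 1)
    (hctx : ∀ t, 1 ≤ t → ∀ ω a, ‖X.context t ω a‖ ≤ 1)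
    (hsub : ∀ t, 1 ≤ t → IsCondSubGaussian P (X.preReward ℱ t) (X.noise μstar t) 1)
    {δ : ℝ} (hδ0 : 0 < δ) (T : ℕ) :
    P {ω | ∃ t ∈ Finset.Icc 1 T, μstar ∉ X.confRegion 1 (confRadius d δ) t ω} ≤
      ENNReal.ofReal (δ / 2) := by
  have hd0 : (0 : ℝ) < d := by exact_mod_cast hd
  -- The reciprocal of the argument of the logarithm in `confRadius`; by `ζ(2) = π²/6` these sum to
  -- at most `δ/2`.
  let ε : ℕ → ℝ := fun t => 3 * δ / (Real.pi ^ 2 * t ^ 2)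
  have hstep : ∀ t ∈ Finset.Icc 1 T,
      P {ω | μstar ∉ X.confRegion 1 (confRadius d δ) t ω} ≤ ENNReal.ofReal (ε t) := by
    intro t ht
    have ht1 := (Finset.mem_Icc.mp ht).1
    have ht0 : (0 : ℝ) < t := by exact_mod_cast ht1
    refine (measure_mono fun ω hω => ?_).trans
      (measure_noiseSum_gt_le hX hsub ht1 (ε := ε t) (by positivity))
    rw [Set.mem_ofPred_eq] at hω ⊢
    by_contra! hle
    refine hω ((X.sqrt_sub_ridge_le μstar hμ t ω).trans ?_)
    rw [confRadius, Real.sqrt_sq (by positivity)]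
    gcongr
    refine hle.trans (add_le_add ?_ ?_)
    -- `V_t` contains only `t - 1` contexts, while the radius allows for `t`.
    · obtain ⟨s, rfl⟩ : ∃ s, t = s + 1 := ⟨t - 1, by omega⟩
      refine (X.log_det_covMatrix_le hd s ω fun τ hτ =>
        dotProduct_ofLp_self_le_one (hctx τ hτ ω _)).trans ?_
      gcongr
      omega
    · simp only [ε, one_div_div]
      exact le_rfl
  calc P {ω | ∃ t ∈ Finset.Icc 1 T, μstar ∉ X.confRegion 1 (confRadius d δ) t ω}
      = P (⋃ t ∈ Finset.Icc 1 T, {ω | μstar ∉ X.confRegion 1 (confRadius d δ) t ω}) := by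
        congr 1
        ext ω
        simp
    _ ≤ ∑ t ∈ Finset.Icc 1 T, P {ω | μstar ∉ X.confRegion 1 (confRadius d δ) t ω} :=
        measure_biUnion_finset_le _ _
    _ ≤ ∑ t ∈ Finset.Icc 1 T, ENNReal.ofReal (ε t) := Finset.sum_le_sum hstep
    _ = ENNReal.ofReal (∑ t ∈ Finset.Icc 1 T, ε t) :=
        (ENNReal.ofReal_sum_of_nonneg fun t _ => by positivity).symm
    _ ≤ ENNReal.ofReal (δ / 2) := by
        refine ENNReal.ofReal_le_ofReal ?_
        have h : ∀ t, ε t = 3 * δ / Real.pi ^ 2 * (1 / (t : ℝ) ^ 2) := fun t => by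
          simp only [ε]
          rw [div_mul_div_comm, mul_one]
        simp only [h]
        rw [← Finset.mul_sum]
        calc 3 * δ / Real.pi ^ 2 * ∑ t ∈ Finset.Icc 1 T, 1 / (t : ℝ) ^ 2
            ≤ 3 * δ / Real.pi ^ 2 * (Real.pi ^ 2 / 6) := by
              gcongr
              exact sum_le_hasSum _ (fun _ _ => by positivity) hasSum_zeta_two
          _ = δ / 2 := by
              field_simp
              norm_num

end Interaction

/-! ### Bounds by the common logarithm -/

theorem one_le_log_two_add_div {δ : ℝ} (hδ0 : 0 < δ) (hδ1 : δ < 1) {T : ℕ} (hT : 1 ≤ T) :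
    1 ≤ Real.log (2 + T / δ) := by
  have hT' : (1 : ℝ) ≤ T := by exact_mod_cast hT
  have : 1 ≤ T / δ := (one_le_div hδ0).mpr (hδ1.le.trans hT')
  rw [Real.le_log_iff_exp_le (by linarith)]
  linarith [Real.exp_one_lt_d9]

theorem log_one_add_div_le {d : ℕ} (hd : 1 ≤ d) {δ : ℝ} (hδ0 : 0 < δ) (hδ1 : δ < 1) {t T : ℕ}
    (htT : t ≤ T) : Real.log (1 + t / d) ≤ Real.log (2 + T / δ) := by
  have hd' : (1 : ℝ) ≤ d := by exact_mod_cast hd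
  have h : (t : ℝ) ≤ T := by exact_mod_cast htT
  refine Real.log_le_log (by positivity) (add_le_add one_le_two ?_)
  exact div_le_div₀ (Nat.cast_nonneg T) h hδ0 (hδ1.le.trans hd')

theorem sqrt_confRadius_le {d : ℕ} (hd : 1 ≤ d) {δ : ℝ} (hδ0 : 0 < δ) (hδ1 : δ < 1) {t T : ℕ}
    (ht : 1 ≤ t) (htT : t ≤ T) :
    √(confRadius d δ t) ≤ 4 * √(d * Real.log (2 + T / δ)) := by
  have hd' : (1 : ℝ) ≤ d := by exact_mod_cast hd
  have ht' : (1 : ℝ) ≤ t := by exact_mod_cast ht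
  have h : (t : ℝ) ≤ T := by exact_mod_cast htT
  have hℓ := one_le_log_two_add_div hδ0 hδ1 (ht.trans htT)
  set ℓ := Real.log (2 + T / δ) with hℓdef
  -- From `π² ≤ 12` and `δ < 1`, the argument is at most `(2t/δ)² ≤ (2 + T/δ)⁴`.
  have hlog : Real.log (Real.pi ^ 2 * t ^ 2 / (3 * δ)) ≤ 4 * ℓ := by
    rw [hℓdef, show (4 : ℝ) = (4 : ℕ) by norm_num, ← Real.log_pow]
    refine Real.log_le_log (by positivity) ?_
    have hu : (t : ℝ) / δ ≤ T / δ := by gcongr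
    have hu0 : 0 ≤ (t : ℝ) / δ := by positivity
    have hpi : Real.pi ^ 2 ≤ 12 := by nlinarith [Real.pi_lt_d2, Real.pi_pos]
    calc Real.pi ^ 2 * t ^ 2 / (3 * δ) ≤ 12 * t ^ 2 / (3 * δ ^ 2) := by
          gcongr
          nlinarith
      _ = (2 * (t / δ)) ^ 2 := by field_simp; norm_num
      _ ≤ ((2 + T / δ) ^ 2) ^ 2 := by
          gcongr
          nlinarith
      _ = (2 + T / δ) ^ 4 := by ring
  have hone : 1 ≤ √(d * ℓ) := Real.one_le_sqrt.mpr (one_le_mul_of_one_le_of_one_le hd' hℓ)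
  rw [confRadius, Real.sqrt_sq (by positivity)]
  have hlog1 := log_one_add_div_le hd hδ0 hδ1 htT
  -- The radicand is at most `dℓ + 8ℓ ≤ 9dℓ`; the leading 1 of the radius costs one more `√(dℓ)`.
  have : √(d * Real.log (1 + t / d) + 2 * Real.log (Real.pi ^ 2 * t ^ 2 / (3 * δ))) ≤
      3 * √(d * ℓ) := by
    rw [show (3 : ℝ) = √(3 ^ 2) by rw [Real.sqrt_sq (by norm_num)],
      ← Real.sqrt_mul (by norm_num)]
    refine Real.sqrt_le_sqrt ?_
    have h1 : d * Real.log (1 + t / d) ≤ d * ℓ := by gcongr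
    have h2 : ℓ ≤ d * ℓ := le_mul_of_one_le_left (by linarith) hd'
    linarith
  linarith

/-! ### Pathwise bounds and the conclusion -/

namespace Interaction

variable {Ω : Type*} {d K : ℕ}

theorem fairnessRegret_le (X : Interaction Ω d K) {f : ℝ → ℝ} {γ L : ℝ} (hγ : 0 < γ)
    (hL : 0 < L) (hmin : ∀ y, γ ≤ f y) (hlip : ∀ y z, |f y - f z| ≤ L * |y - z|)
    {μstar : Vec d} {β : ℕ → ℝ} {T : ℕ} {ω : Ω} {b : ℝ}
    (hβ : ∀ t ∈ Finset.Icc 1 T, √(β t) ≤ b)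
    (hμ : ∀ t ∈ Finset.Icc 1 T, μstar ∈ X.confRegion 1 β t ω)
    (hθ : ∀ t ∈ Finset.Icc 1 T, X.param t ω ∈ X.confRegion 1 β t ω) :
    X.fairnessRegret f μstar T ω ≤
      2 * L / γ * (2 * b * ∑ t ∈ Finset.Icc 1 T, X.meanWidth f t ω) := by
  rw [fairnessRegret, Finset.mul_sum, Finset.mul_sum]
  refine Finset.sum_le_sum fun t ht => ?_
  refine (sum_abs_fairPolicy_sub_le hγ hmin hlip μstar (X.param t ω) (X.context t ω)).trans ?_
  refine mul_le_mul_of_nonneg_left ?_ (by positivity)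
  rw [meanWidth, Finset.mul_sum]
  refine Finset.sum_le_sum fun a _ => ?_
  calc fairPolicy f (X.param t ω) (X.context t ω) a *
        |inner ℝ μstar (X.context t ω a) - inner ℝ (X.param t ω) (X.context t ω a)|
      ≤ fairPolicy f (X.param t ω) (X.context t ω) a *
          (2 * √(β t) * X.width t ω (X.context t ω a)) :=
        mul_le_mul_of_nonneg_left (X.abs_inner_sub_le (hμ t ht) (hθ t ht) _)
          (fairPolicy_nonneg (fun y => hγ.trans_le (hmin y)) _ _ _)
    _ ≤ fairPolicy f (X.param t ω) (X.context t ω) a *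
          (2 * b * X.width t ω (X.context t ω a)) :=
        mul_le_mul_of_nonneg_left (mul_le_mul_of_nonneg_right
          (mul_le_mul_of_nonneg_left (hβ t ht) zero_le_two) (X.width_nonneg _ _ _))
          (fairPolicy_nonneg (fun y => hγ.trans_le (hmin y)) _ _ _)
    _ = 2 * b * (X.policy f t ω a * X.width t ω (X.context t ω a)) := by
        rw [policy]
        ring

theorem sum_width_chosen_le (X : Interaction Ω d K) (hd : 1 ≤ d) {δ : ℝ} (hδ0 : 0 < δ)
    (hδ1 : δ < 1) (T : ℕ) (ω : Ω) (hx : ∀ τ, 1 ≤ τ → ‖X.chosen τ ω‖ ≤ 1) :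
    ∑ t ∈ Finset.Icc 1 T, X.width t ω (X.chosen t ω) ≤
      2 * √T * √(d * Real.log (2 + T / δ)) := by
  have hℓ : 0 ≤ Real.log (2 + T / δ) :=
    Real.log_nonneg (by linarith [div_nonneg (Nat.cast_nonneg (α := ℝ) T) hδ0.le])
  refine abs_le_of_sq_le_sq' ?_ (by positivity) |>.2
  rw [mul_pow, mul_pow, Real.sq_sqrt (Nat.cast_nonneg T), Real.sq_sqrt (by positivity)]
  calc (∑ t ∈ Finset.Icc 1 T, X.width t ω (X.chosen t ω)) ^ 2
      ≤ T * ∑ t ∈ Finset.Icc 1 T, X.width t ω (X.chosen t ω) ^ 2 := by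
        simpa using sq_sum_le_card_mul_sum_sq (s := Finset.Icc 1 T)
          (f := fun t => X.width t ω (X.chosen t ω))
    _ ≤ T * (2 * (d * Real.log (1 + T / d))) := by
        gcongr
        exact X.sum_width_sq_le hd T ω hx
    _ ≤ T * (2 * (d * Real.log (2 + T / δ))) := by
        have := log_one_add_div_le hd hδ0 hδ1 (le_refl T)
        gcongr T * (2 * (d * ?_))
    _ ≤ 2 ^ 2 * T * (d * Real.log (2 + T / δ)) := by
        have : 0 ≤ (T : ℝ) * (d * Real.log (2 + T / δ)) := by positivity
        linarith

end Interaction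

theorem theorem8 :
    ∃ (C : ℝ) (k : ℕ),
      ∀ (d K : ℕ) (_hd : 1 ≤ d)
        (f : ℝ → ℝ) (γ L : ℝ) (_hγ : 0 < γ) (_hL : 0 < L)
        (_hmin : ∀ y : ℝ, γ ≤ f y)
        (_hlip : ∀ y z : ℝ, |f y - f z| ≤ L * |y - z|)
        (μstar : Vec d) (_hμ : ‖μstar‖ ≤ 1)
        (δ : ℝ) (_hδ0 : 0 < δ) (_hδ1 : δ < 1)
        (Ω : Type*) (mΩ : MeasurableSpace Ω) (P : Measure Ω) (_hP : IsProbabilityMeasure P)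
        (ℱ : Filtration ℕ mΩ) (X : Interaction Ω d K)
        (_hbandit : X.IsLinearBandit P ℱ μstar)
        (_hctx : ∀ t, 1 ≤ t → ∀ ω a, ‖X.context t ω a‖ ≤ 1)
        (_hsub : ∀ t, 1 ≤ t → IsCondSubGaussian P (X.preReward ℱ t) (X.noise μstar t) 1)
        (_halg : X.IsFairXLinUCB P ℱ (confRadius d δ) f 1)
        (T : ℕ) (_hT : 1 ≤ T),
        1 - δ ≤ P.real {ω | X.fairnessRegret f μstar T ω ≤
          C * (L * d * √(T : ℝ) / γ) * Real.log (2 + T / δ) ^ k} := by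
  -- `128 = 2·(2·4)·(4 + 4)`: policy distance, ellipsoid diameter, sum of expected widths. One
  -- logarithm comes from `q² = dℓ`, the other from the lower-order term.
  refine ⟨128, 2, ?_⟩
  intro d K hd f γ L hγ hL hmin hlip μstar hμ δ hδ0 hδ1 Ω mΩ P hP ℱ X hX hctx hsub hA T hT
  have hf : Measurable f := by
    have : LipschitzWith (Real.toNNReal L) f := LipschitzWith.of_dist_le_mul fun y z => by
      rw [Real.dist_eq, Real.dist_eq, Real.coe_toNNReal _ hL.le]
      exact hlip y z
    exact this.continuous.measurable
  have hf0 : ∀ y, 0 < f y := fun y => hγ.trans_le (hmin y)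
  set A : Set Ω := {ω | ∃ t ∈ Finset.Icc 1 T, μstar ∉ X.confRegion 1 (confRadius d δ) t ω}
  set B : Set Ω := {ω | 2 * ∑ t ∈ Finset.Icc 1 T, X.width t ω (X.chosen t ω) +
    2 * Real.log (1 / (δ / 2)) < ∑ t ∈ Finset.Icc 1 T, X.meanWidth f t ω}
  set G : Set Ω := {ω | X.fairnessRegret f μstar T ω ≤
    128 * (L * d * √(T : ℝ) / γ) * Real.log (2 + T / δ) ^ 2}
  have hPA : P.real A ≤ δ / 2 := ENNReal.toReal_le_of_le_ofReal (by positivity)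
    (Interaction.measure_notMem_confRegion_le hd hX hμ hctx hsub hδ0 T)
  have hPB : P.real B ≤ δ / 2 := ENNReal.toReal_le_of_le_ofReal (by positivity)
    (Interaction.measure_sum_meanWidth_gt_le hX hA hf hf0 hctx T (half_pos hδ0))
  -- Covering the space and using subadditivity avoids any measurability of the three events.
  have hcover : (Set.univ : Set Ω) ⊆ G ∪ (A ∪ B) := by
    intro ω _
    by_contra hω
    simp only [Set.mem_union, not_or] at hω
    obtain ⟨hG, hnA, hnB⟩ := hω
    simp only [A, B, Set.mem_ofPred_eq, not_exists, not_and, not_not, not_lt] at hnA hnB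
    refine hG ?_
    change X.fairnessRegret f μstar T ω ≤ _
    have hreg := X.fairnessRegret_le hγ hL hmin hlip (μstar := μstar) (T := T) (ω := ω)
      (fun t ht => sqrt_confRadius_le hd hδ0 hδ1 (Finset.mem_Icc.mp ht).1 (Finset.mem_Icc.mp ht).2)
      hnA fun t ht => hA.param_mem t (Finset.mem_Icc.mp ht).1 ω
    have hsum := X.sum_width_chosen_le hd hδ0 hδ1 T ω fun τ hτ => hctx τ hτ ω _
    have hℓ := one_le_log_two_add_div hδ0 hδ1 hT
    -- Since `T ≥ 1`, `2/δ ≤ (2 + T/δ)²`.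
    have hlog : Real.log (1 / (δ / 2)) ≤ 2 * Real.log (2 + T / δ) := by
      rw [show (2 : ℝ) * Real.log (2 + T / δ) = (2 : ℕ) * Real.log (2 + T / δ) by norm_num,
        ← Real.log_pow]
      refine Real.log_le_log (by positivity) ?_
      have hT' : (1 : ℝ) ≤ T := by exact_mod_cast hT
      have : 1 / δ ≤ T / δ := by gcongr
      have h0 : 0 < 1 / δ := by positivity
      rw [one_div_div, show 2 / δ = 2 * (1 / δ) by ring]
      nlinarith
    set ℓ := Real.log (2 + T / δ)
    set q := √(d * ℓ)
    set s := √(T : ℝ)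
    have hd' : (1 : ℝ) ≤ d := by exact_mod_cast hd
    have hs : 1 ≤ s := Real.one_le_sqrt.mpr (by exact_mod_cast hT)
    have hq2 : q ^ 2 = d * ℓ := Real.sq_sqrt (by positivity)
    have hq1 : 1 ≤ q := Real.one_le_sqrt.mpr (one_le_mul_of_one_le_of_one_le hd' hℓ)
    have hmean : ∑ t ∈ Finset.Icc 1 T, X.meanWidth f t ω ≤ 4 * s * q + 4 * ℓ := by linarith
    calc X.fairnessRegret f μstar T ω
        ≤ 2 * L / γ * (2 * (4 * q) * ∑ t ∈ Finset.Icc 1 T, X.meanWidth f t ω) := hreg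
      _ ≤ 2 * L / γ * (2 * (4 * q) * (4 * s * q + 4 * ℓ)) := by gcongr
      _ = 64 * (L / γ) * (s * q ^ 2 + q * ℓ) := by ring
      _ ≤ 64 * (L / γ) * (s * q ^ 2 * ℓ + s * q ^ 2 * ℓ) := by
          have h1 : s * q ^ 2 ≤ s * q ^ 2 * ℓ := le_mul_of_one_le_right (by positivity) hℓ
          have h2 : q ≤ s * q ^ 2 := (le_self_pow₀ hq1 two_ne_zero).trans
            (le_mul_of_one_le_left (by positivity) hs)
          exact mul_le_mul_of_nonneg_left
            (add_le_add h1 (mul_le_mul_of_nonneg_right h2 (by positivity))) (by positivity)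
      _ = 128 * (L * d * s / γ) * ℓ ^ 2 := by
          rw [hq2]
          ring
  have htotal : 1 ≤ P.real G + (P.real A + P.real B) := by
    calc (1 : ℝ) = P.real Set.univ := by simp
      _ ≤ P.real (G ∪ (A ∪ B)) := measureReal_mono hcover
      _ ≤ P.real G + P.real (A ∪ B) := measureReal_union_le _ _
      _ ≤ _ := by gcongr; exact measureReal_union_le _ _
  linarith
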